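/- For $d\ge 2$ let $\mathbb T_d$ be the infinite $d$-ary tree with root $\rho$ (every vertex has exactly $d$ children), and let $\mathbb T_d^n$ be the subtree induced by the vertices within distance $n$ of $\rho$; its leaves are the vertices at distance $n$ from $\rho$. A Lipschitz function on a graph is an integer-valued function $f$ on its vertices with $|f(u)-f(v)|\le 1$ whenever $u\sim v$. A weight sequence $w\colon\mathbb Z\to[0,\infty)$ is called good if $w(i)=w(-i)$ for all $i\in\mathbb Z$, $w(0)>0$, and there exist an integer $k\ge 0$ and a number $c\in[0,1)$ such that $w(i)=w(i+1)$ for all $0\le i<k$ and $w(i+1)\le c\,w(i)$ for all $i\ge k$. For such $w$, let $\mu_{n,d}^w$ be the probability measure on the Lipschitz functions $f$ on $\mathbb T_d^n$ that gives $f$ probability proportional to $\prod_{v} w(f(v))$, the product being over the leaves $v$ of $\mathbb T_d^n$. For a finite nonempty set $S\subset\mathbb Z$, let $\mu_{n,d}^S$ be the uniform probability measure on the Lipschitz functions on $\mathbb T_d^n$ all of whose values on the leaves lie in $S$. We say that such measures $\nu_n$ on functions on $\mathbb T_d^n$ converge locally to a probability measure $\mu$ on integer-valued functions on $\mathbb T_d$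 if, for every $r\ge 0$, the law under $\nu_n$ of the restriction to $\mathbb T_d^r$ (defined for $n \ge r$) converges weakly, as $n\to\infty$, to the law under $\mu$ of the restriction to $\mathbb T_d^r$. **Theorem.** Let $2\le d\le 7$. There is a probability measure $\mu$ on integer-valued functions on $\mathbb T_d$ such that, for every good weight sequence $w$, the measures $\mu_{n,d}^w$ are well defined and converge locally to $\mu$ as $n\to\infty$; that is, $\lim_{n\to\infty}\mu_{n,d}^w$ exists and does not depend on $w$. In particular, for every integer $k\ge 0$, the measures $\mu_{n,d}^{\{-k,\ldots,k\}}$ converge locally to the same limit $\mu$. -/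

import Mathlib

open MeasureTheory Filter Topology
open scoped ENNReal NNReal

namespace LipschitzTree

/-- The rooted `d`-ary tree. Vertices are finite words over an alphabet of `d` letters, the root is
the empty word, and the `d` children of a word `u` are the words `a :: u`. The distance of a vertex
from the root is the length of the word. -/
def daryTree (d : ℕ) : SimpleGraph (List (Fin d)) :=
  SimpleGraph.fromRel fun u v => ∃ a : Fin d, v = a :: u

/-- The vertices of the `d`-ary tree within distance `n` from the root. -/
def ball (d n : ℕ) : Set (List (Fin d)) := {v | v.length ≤ n}

/-- The `d`-ary tree of height `n`: the subgraph induced by the vertices within distance `n` from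
the root. -/
def finiteTree (d n : ℕ) : SimpleGraph (ball d n) := (daryTree d).induce (ball d n)

/-- Integer-valued functions on the vertices of the `d`-ary tree of height `n`. -/
abbrev Config (d n : ℕ) : Type := ball d n → ℤ

/-- The leaves of the `d`-ary tree of height `n`: the vertices at distance exactly `n` from the
root. They are indexed by the words of length `n`. -/
def leaf {d n : ℕ} (v : List.Vector (Fin d) n) : ball d n := ⟨v.1, v.2.le⟩

/-- A (1-)Lipschitz function on a graph. -/
def IsLipschitz {V : Type*} (G : SimpleGraph V) (f : V → ℤ) : Prop :=
  ∀ u v, G.Adj u v → |f u - f v| ≤ 1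

/-- Good weight sequences: symmetric, positive at `0`, constant on some interval `{-k, …, k}`, and
decaying at least at an exponential rate `c < 1` outside this interval. -/
def IsGood (w : ℤ → ℝ≥0) : Prop :=
  (∀ i, w (-i) = w i) ∧ 0 < w 0 ∧
    ∃ k : ℕ, ∃ c : ℝ≥0, c < 1 ∧
      (∀ i : ℤ, 0 ≤ i → i < k → w i = w (i + 1)) ∧
      (∀ i : ℤ, (k : ℤ) ≤ i → w (i + 1) ≤ c * w i)

/-- The weight of a function on the `d`-ary tree of height `n`: the product of `w (f v)` over the
leaves `v` if `f` is Lipschitz, and `0` otherwise. -/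
noncomputable def weight (d n : ℕ) (w : ℤ → ℝ≥0) : Config d n → ℝ≥0∞ :=
  Set.indicator {f | IsLipschitz (finiteTree d n) f}
    fun f => ∏ v : List.Vector (Fin d) n, (w (f (leaf v)) : ℝ≥0∞)

/-- The law `μ_{n,d}^w` of a random Lipschitz function on the `d`-ary tree of height `n`, chosen
with probability proportional to its weight. -/
noncomputable def weightedLaw (d : ℕ) (w : ℤ → ℝ≥0) (n : ℕ) : Measure (Config d n) :=
  (∑' f, weight d n w f)⁻¹ • Measure.sum fun f => weight d n w f • Measure.dirac f

/-- The Lipschitz functions on the `d`-ary tree of height `n` with values in `S` on the leaves. -/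
def lipschitzFunctions (d n : ℕ) (S : Set ℤ) : Set (Config d n) :=
  {f | IsLipschitz (finiteTree d n) f ∧ ∀ v : List.Vector (Fin d) n, f (leaf v) ∈ S}

/-- The uniform law `μ_{n,d}^S` on the Lipschitz functions with values in `S` on the leaves. -/
noncomputable def uniformLaw (d : ℕ) (S : Set ℤ) (n : ℕ) : Measure (Config d n) :=
  ProbabilityTheory.uniformOn (lipschitzFunctions d n S)

/-- Restriction to the ball of radius `r` of a function on the tree of height `n + r`. -/
def restrictConfig (d r n : ℕ) (f : Config d (n + r)) : Config d r :=
  fun v => f ⟨v.1, le_trans v.2 (Nat.le_add_left r n)⟩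

/-- Restriction to the ball of radius `r` of a function on the infinite tree. -/
def restrictInfinite (d r : ℕ) (f : List (Fin d) → ℤ) : Config d r := fun v => f v.1

theorem measurable_restrictConfig (d r n : ℕ) : Measurable (restrictConfig d r n) :=
  measurable_pi_lambda _ fun _ => measurable_pi_apply _

theorem measurable_restrictInfinite (d r : ℕ) : Measurable (restrictInfinite d r) :=
  measurable_pi_lambda _ fun _ => measurable_pi_apply _

/-- Local weak convergence: the `ν n`, laws of functions on the trees of height `n`, are
probability measures, and for every `r` the law under `ν n` of the restriction to the ball of
radius `r` converges weakly, as `n → ∞`, to the corresponding law under the probability measure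
`μ` on functions on the infinite tree. (Restrictions are defined for heights at least `r`, so the
height is written `n + r`.) -/
def ConvergesLocally {d : ℕ} (ν : (n : ℕ) → Measure (Config d n))
    (μ : ProbabilityMeasure (List (Fin d) → ℤ)) : Prop :=
  ∃ h : ∀ n, IsProbabilityMeasure (ν n), ∀ r : ℕ,
    Tendsto
      (fun n : ℕ => ProbabilityMeasure.map (⟨ν (n + r), h (n + r)⟩ : ProbabilityMeasure _)
        (measurable_restrictConfig d r n).aemeasurable)
      atTop (𝓝 (μ.map (measurable_restrictInfinite d r).aemeasurable))

end LipschitzTree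

/-! Given a Lipschitz function on the ball of radius `n`, the possible values at the leaves of
height `n + 1` are chosen independently. Summing them out replaces `w` by `stepWeight d w`
(`tsum_weight_extensions`), so the law on a fixed ball is governed by iterates of this map. Scalar
factors cancel in the normalisation, so only the ratios `r i = w (i + 1) / w i` matter; they evolve
under `ratioMap d`. The core is that one fixed point `ρ` attracts the ratios of every good weight
(`exists_limit_ratio`).

Ratios of good weights lie in `[0, 1]` and are eventually bounded away from `1`. The value `1`
repels the tail, so after finitely many levels `r i ≤ 1/2` for all `i ≥ 1`
(`eventually_iterate_ratioMap_le_half`). From then on, bounds `m ≤ r 0 ≤ M` and `r i ≤ t` for `i ≥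
1` propagate explicitly. Iterating them in exact integer arithmetic from `(0, 1, 1/2)` gives a small
box (`eventually_inScaledBox`), on which `ratioMap d` contracts by `99/100` in a weighted sup norm
(`ContractionBounds`). When the tail is negligible, `r 0` nearly follows `x ↦ ((1 + x) / (1 + 2 x))
^ d`, whose slope at its fixed point is about `-0.96` for `d = 7` and below `-1` for `d = 8`.

The weight `W` with ratios `ρ` is invariant up to a scalar, so its laws on balls are consistent and
define `μ` by compactness. Dominated convergence carries the convergence of ratios over to the laws
on balls. -/

namespace LipschitzTree

/-! ### The recursion for the ratios of consecutive weights -/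

/-- The factor whose `d`-th power is the updated ratio of the weights at `1` and `0`. -/
noncomputable def rootFactor (a b : ℝ) : ℝ := (1 + a + a * b) / (1 + 2 * a)

/-- The factor whose `d`-th power is the updated ratio of the weights at `i + 1` and `i`, for
`i ≥ 1`. -/
noncomputable def ratioFactor (p q s : ℝ) : ℝ := p * (1 + q + q * s) / (1 + p + p * q)

/-- The action of one level of the `d`-ary tree on the sequence of ratios `w (i + 1) / w i`. -/
noncomputable def ratioMap (d : ℕ) (r : ℕ → ℝ) : ℕ → ℝ
  | 0 => rootFactor (r 0) (r 1) ^ d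
  | i + 1 => ratioFactor (r i) (r (i + 1)) (r (i + 2)) ^ d

theorem rootFactor_nonneg {a b : ℝ} (ha : 0 ≤ a) (hb : 0 ≤ b) : 0 ≤ rootFactor a b := by
  unfold rootFactor; positivity

theorem ratioFactor_nonneg {p q s : ℝ} (hp : 0 ≤ p) (hq : 0 ≤ q) (hs : 0 ≤ s) :
    0 ≤ ratioFactor p q s := by
  unfold ratioFactor; positivity

/-- The factor equals `1 - a * (1 - b) / (1 + 2 * a)`, which increases in `b` and, for `b ≤ 1`,
decreases in `a`. -/
theorem rootFactor_le {m t a b : ℝ} (hm : 0 ≤ m) (ha : m ≤ a) (hb : b ≤ t)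
    (ht : t ≤ 1) : rootFactor a b ≤ rootFactor m t := by
  unfold rootFactor
  have ha' : 0 ≤ a := hm.trans ha
  rw [div_le_div_iff₀ (by positivity) (by positivity)]
  have h1 : a * b ≤ a * t := mul_le_mul_of_nonneg_left hb ha'
  nlinarith [mul_nonneg (sub_nonneg.2 ha) (sub_nonneg.2 ht), mul_le_mul_of_nonneg_right h1 hm]

theorem le_rootFactor {M a b : ℝ} (ha : 0 ≤ a) (hM : a ≤ M) (hb : 0 ≤ b) :
    rootFactor M 0 ≤ rootFactor a b := by
  unfold rootFactor
  have hM' : 0 ≤ M := ha.trans hM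
  rw [div_le_div_iff₀ (by positivity) (by positivity)]
  nlinarith [mul_nonneg ha hb, mul_nonneg (mul_nonneg ha hb) hM']

theorem ratioFactor_mono {p q s p' q' s' : ℝ} (hp : 0 ≤ p) (hq : 0 ≤ q) (hs : 0 ≤ s)
    (hpp : p ≤ p') (hqq : q ≤ q') (hss : s ≤ s') : ratioFactor p q s ≤ ratioFactor p' q' s' := by
  have hp' := hp.trans hpp
  have hq' := hq.trans hqq
  have hs' := hs.trans hss
  unfold ratioFactor
  calc p * (1 + q + q * s) / (1 + p + p * q) ≤ p * (1 + q + q * s') / (1 + p + p * q) := by gcongr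
    _ ≤ p * (1 + q' + q' * s') / (1 + p + p * q') := by
        rw [div_le_div_iff₀ (by positivity) (by positivity)]
        have h : 0 ≤ p * ((q' - q) * (1 + s' + s' * p)) :=
          mul_nonneg hp (mul_nonneg (sub_nonneg.2 hqq) (by positivity))
        linarith
    _ ≤ p' * (1 + q' + q' * s') / (1 + p' + p' * q') := by
        rw [div_le_div_iff₀ (by positivity) (by positivity)]
        have h : 0 ≤ (1 + q' + q' * s') * (p' - p) :=
          mul_nonneg (by positivity) (sub_nonneg.2 hpp)
        linarith

theorem rootFactor_le_one {a b : ℝ} (ha : 0 ≤ a) (hb : b ≤ 1) : rootFactor a b ≤ 1 := by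
  unfold rootFactor
  rw [div_le_one (by positivity)]
  nlinarith [mul_le_mul_of_nonneg_left hb ha]

theorem ratioFactor_le_one {p q s : ℝ} (hp : 0 ≤ p) (hq : 0 ≤ q) (hs : 0 ≤ s) (hp' : p ≤ 1)
    (hq' : q ≤ 1) (hs' : s ≤ 1) : ratioFactor p q s ≤ 1 := by
  refine (ratioFactor_mono hp hq hs hp' hq' hs').trans ?_
  norm_num [ratioFactor]

theorem ratioMap_mem {d : ℕ} {r : ℕ → ℝ} (hr : ∀ i, r i ∈ Set.Icc (0 : ℝ) 1) (i : ℕ) :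
    ratioMap d r i ∈ Set.Icc (0 : ℝ) 1 := by
  have h0 := fun i => (hr i).1
  have h1 := fun i => (hr i).2
  cases i with
  | zero =>
    exact ⟨pow_nonneg (rootFactor_nonneg (h0 _) (h0 _)) _,
      pow_le_one₀ (rootFactor_nonneg (h0 _) (h0 _)) (rootFactor_le_one (h0 _) (h1 _))⟩
  | succ i =>
    exact ⟨pow_nonneg (ratioFactor_nonneg (h0 _) (h0 _) (h0 _)) _,
      pow_le_one₀ (ratioFactor_nonneg (h0 _) (h0 _) (h0 _))
        (ratioFactor_le_one (h0 _) (h0 _) (h0 _) (h1 _) (h1 _) (h1 _))⟩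

theorem iterate_ratioMap_mem {d : ℕ} {r : ℕ → ℝ} (hr : ∀ i, r i ∈ Set.Icc (0 : ℝ) 1) (n i : ℕ) :
    (ratioMap d)^[n] r i ∈ Set.Icc (0 : ℝ) 1 := by
  induction n generalizing i with
  | zero => exact hr i
  | succ n ih => rw [Function.iterate_succ_apply']; exact ratioMap_mem ih i

theorem tendsto_ratioMap_apply {d : ℕ} {u : ℕ → ℕ → ℝ} {ρ : ℕ → ℝ} (hρ : ∀ i, 0 ≤ ρ i)
    (h : ∀ i, Tendsto (fun n => u n i) atTop (𝓝 (ρ i))) (i : ℕ) :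
    Tendsto (fun n => ratioMap d (u n) i) atTop (𝓝 (ratioMap d ρ i)) := by
  cases i with
  | zero =>
    have := hρ 0
    exact (((tendsto_const_nhds.add (h 0)).add ((h 0).mul (h 1))).div
      (tendsto_const_nhds.add (tendsto_const_nhds.mul (h 0))) (by positivity)).pow d
  | succ i =>
    have h0 := hρ i
    have h1 := hρ (i + 1)
    exact (((h i).mul ((tendsto_const_nhds.add (h (i + 1))).add
      ((h (i + 1)).mul (h (i + 2))))).div
      ((tendsto_const_nhds.add (h i)).add ((h i).mul (h (i + 1)))) (by positivity)).pow d

/-! ### Eventual decay of the ratios -/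

theorem ratioMap_succ_le_of_tail_le {d k : ℕ} (hd : d ≠ 0) {r : ℕ → ℝ} {c : ℝ}
    (hr : ∀ i, r i ∈ Set.Icc (0 : ℝ) 1) (h : ∀ i, k + 2 ≤ i → r i ≤ c) (i : ℕ)
    (hi : k ≤ i) : ratioMap d r (i + 1) ≤ (2 + c) / 3 := by
  have h0 := fun i => (hr i).1
  have h1 := fun i => (hr i).2
  have hc : 0 ≤ c := (h0 (k + 2)).trans (h _ le_rfl)
  calc ratioMap d r (i + 1) ≤ ratioFactor (r i) (r (i + 1)) (r (i + 2)) :=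
        pow_le_of_le_one (ratioFactor_nonneg (h0 _) (h0 _) (h0 _))
          (ratioFactor_le_one (h0 _) (h0 _) (h0 _) (h1 _) (h1 _) (h1 _)) hd
    _ ≤ ratioFactor 1 1 c :=
        ratioFactor_mono (h0 _) (h0 _) (h0 _) (h1 _) (h1 _) (h _ (by omega))
    _ = (2 + c) / 3 := by unfold ratioFactor; ring

/-- The new ratio at `i + 1` involves the old one at `i + 2`, so each level moves the start of the
region with a bound below `1` one step to the left, weakening `c` to `(2 + c) / 3`. After `k` levels
the region covers all indices from `1` on. -/
theorem exists_iterate_ratioMap_le {d : ℕ} (hd : d ≠ 0) (k : ℕ) {r : ℕ → ℝ} {c : ℝ}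
    (hr : ∀ i, r i ∈ Set.Icc (0 : ℝ) 1) (hc : c < 1) (h : ∀ i, k + 1 ≤ i → r i ≤ c) :
    ∃ n, ∃ c' < 1, ∀ i, (ratioMap d)^[n] r (i + 1) ≤ c' := by
  induction k generalizing r c with
  | zero => exact ⟨0, c, hc, fun i => h _ (by omega)⟩
  | succ k ih =>
    obtain ⟨n, c', hc', hn⟩ := ih (r := ratioMap d r) (c := (2 + c) / 3) (ratioMap_mem hr)
      (by linarith) (fun i hi => by
        obtain ⟨j, rfl⟩ : ∃ j, i = j + 1 := ⟨i - 1, by omega⟩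
        exact ratioMap_succ_le_of_tail_le hd hr h j (by omega))
    exact ⟨n + 1, c', hc', hn⟩

theorem ratioMap_succ_le_sq {d : ℕ} (hd : 2 ≤ d) {r : ℕ → ℝ} {t : ℝ}
    (hr : ∀ i, r i ∈ Set.Icc (0 : ℝ) 1) (h : ∀ i, r (i + 1) ≤ t) (i : ℕ) :
    ratioMap d r (i + 1) ≤ ((1 + t + t * t) / (2 + t)) ^ 2 := by
  have h0 := fun i => (hr i).1
  have h1 := fun i => (hr i).2
  have ht0 : 0 ≤ t := (h0 1).trans (h 0)
  calc ratioMap d r (i + 1) ≤ ratioFactor (r i) (r (i + 1)) (r (i + 2)) ^ 2 :=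
        pow_le_pow_of_le_one (ratioFactor_nonneg (h0 _) (h0 _) (h0 _))
          (ratioFactor_le_one (h0 _) (h0 _) (h0 _) (h1 _) (h1 _) (h1 _)) hd
    _ ≤ ratioFactor 1 t t ^ 2 := by
        gcongr
        · exact ratioFactor_nonneg (h0 _) (h0 _) (h0 _)
        · exact ratioFactor_mono (h0 _) (h0 _) (h0 _) (h1 _) (h _) (h _)
    _ = _ := by unfold ratioFactor; congr 2 <;> ring

/-- The map `t ↦ ((1 + t + t²) / (2 + t))²` fixes `1` with slope `4/3`, so `1` is repelling. On
`[1/2, 1]` the distance to `1` grows at least by the factor `73/72`, which is nearly sharp at `t =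
1/2`, where the map takes the value `0.49`. -/
theorem sq_factor_le_max {t x : ℝ} (ht0 : 0 ≤ t) (ht : t ≤ 1)
    (htx : t ≤ max (1 / 2) (1 - x)) :
    ((1 + t + t * t) / (2 + t)) ^ 2 ≤ max (1 / 2) (1 - 73 / 72 * x) := by
  rcases le_total t (1 / 2) with h | h
  · refine le_max_of_le_left ?_
    have : (1 + t + t * t) / (2 + t) ≤ 7 / 10 := by
      rw [div_le_iff₀ (by positivity)]; nlinarith
    calc ((1 + t + t * t) / (2 + t)) ^ 2 ≤ (7 / 10) ^ 2 := by gcongr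
      _ ≤ 1 / 2 := by norm_num
  · have key : ((1 + t + t * t) / (2 + t)) ^ 2 ≤ 1 - 73 / 72 * (1 - t) := by
      rw [div_pow, div_le_iff₀ (by positivity)]
      have h1 : 0 ≤ (1 - t) * (t ^ 3 + 2 * t ^ 2 + t - 1 - (2 + t) ^ 2 / 72) := by
        refine mul_nonneg (by linarith) ?_
        have : (1 / 2 : ℝ) ^ 3 ≤ t ^ 3 := by gcongr
        nlinarith
      nlinarith
    rcases le_max_iff.1 htx with h2 | h2
    · exact le_max_of_le_left (by nlinarith)
    · exact le_max_of_le_right (by nlinarith)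

theorem eventually_iterate_ratioMap_le_half {d k : ℕ} (hd : 2 ≤ d) {r : ℕ → ℝ} {c : ℝ}
    (hr : ∀ i, r i ∈ Set.Icc (0 : ℝ) 1) (hc : c < 1) (h : ∀ i, k ≤ i → r i ≤ c) :
    ∀ᶠ n in atTop, ∀ i, (ratioMap d)^[n] r (i + 1) ≤ 1 / 2 := by
  obtain ⟨N, c', hc', hN⟩ := exists_iterate_ratioMap_le (d := d) (by omega) k hr hc
    (fun i hi => h i (by omega) : ∀ i, k + 1 ≤ i → r i ≤ c)
  have key : ∀ n, ∃ t ≤ (1 : ℝ), t ≤ max (1 / 2) (1 - (73 / 72) ^ n * (1 - c')) ∧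
      ∀ i, (ratioMap d)^[N + n] r (i + 1) ≤ t := by
    intro n
    induction n with
    | zero => exact ⟨c', hc'.le, le_max_of_le_right (by simp), hN⟩
    | succ n ih =>
      obtain ⟨t, ht1, ht, hti⟩ := ih
      have ht0 : 0 ≤ t := (iterate_ratioMap_mem hr _ _).1.trans (hti 0)
      have hx : 0 ≤ (73 / 72 : ℝ) ^ n * (1 - c') := mul_nonneg (by positivity) (by linarith)
      have h2 := sq_factor_le_max ht0 ht1 ht
      refine ⟨((1 + t + t * t) / (2 + t)) ^ 2, ?_, ?_, fun i => ?_⟩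
      · refine h2.trans (max_le (by norm_num) (by nlinarith))
      · rwa [pow_succ' (73 / 72 : ℝ), mul_assoc]
      · rw [← add_assoc, Function.iterate_succ_apply']
        exact ratioMap_succ_le_sq hd (iterate_ratioMap_mem hr _) hti i
  have hlim : Tendsto (fun n : ℕ => (73 / 72 : ℝ) ^ n * (1 - c')) atTop atTop :=
    (tendsto_pow_atTop_atTop_of_one_lt (by norm_num)).atTop_mul_const (by linarith)
  obtain ⟨n₀, hn₀⟩ := eventually_atTop.1 (hlim.eventually_ge_atTop (1 / 2))
  refine eventually_atTop.2 ⟨N + n₀, fun n hn i => ?_⟩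
  obtain ⟨j, rfl⟩ := Nat.exists_eq_add_of_le (show N ≤ n by omega)
  obtain ⟨t, -, ht, hti⟩ := key j
  refine (hti i).trans (ht.trans (max_le le_rfl ?_))
  linarith [hn₀ j (by omega)]

/-! ### Invariant boxes -/

/-- Sequences of ratios whose first term lies in `[m, M]` and whose other terms are at most `t`. -/
structure InBox (m M t : ℝ) (r : ℕ → ℝ) : Prop where
  nonneg : ∀ i, 0 ≤ r i
  le_zero : m ≤ r 0
  zero_le : r 0 ≤ M
  succ_le : ∀ i, r (i + 1) ≤ t

/-- Since `rootFactor` decreases in its first argument, the two ends of the root interval swap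
roles. The `max M t` appears because the new entry `i + 1` depends on the old entry `i`, which may
be the root one. -/
theorem InBox.ratioMap {m M t : ℝ} {r : ℕ → ℝ} (h : InBox m M t r) (d : ℕ) (hm : 0 ≤ m)
    (ht : t ≤ 1) :
    InBox (rootFactor M 0 ^ d) (rootFactor m t ^ d) (ratioFactor (max M t) t t ^ d)
      (ratioMap d r) := by
  have h0 := h.nonneg
  refine ⟨fun i => ?_, ?_, ?_, fun i => ?_⟩
  · cases i with
    | zero => exact pow_nonneg (rootFactor_nonneg (h0 _) (h0 _)) _
    | succ i => exact pow_nonneg (ratioFactor_nonneg (h0 _) (h0 _) (h0 _)) _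
  · exact pow_le_pow_left₀ (rootFactor_nonneg ((h0 0).trans h.zero_le) le_rfl)
      (le_rootFactor (h0 _) h.zero_le (h0 _)) _
  · exact pow_le_pow_left₀ (rootFactor_nonneg (h0 _) (h0 _))
      (rootFactor_le hm h.le_zero (h.succ_le 0) ht) _
  · refine pow_le_pow_left₀ (ratioFactor_nonneg (h0 _) (h0 _) (h0 _))
      (ratioFactor_mono (h0 _) (h0 _) (h0 _) ?_ (h.succ_le _) (h.succ_le _)) _
    cases i with
    | zero => exact le_max_of_le_left h.zero_le
    | succ i => exact le_max_of_le_right (h.succ_le i)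

/-- The bounds `m, M, t` of a box after one step of `ratioMap d`, in units of `1 / S` and rounded
outwards. -/
def boxStep (S d : ℕ) (b : ℕ × ℕ × ℕ) : ℕ × ℕ × ℕ :=
  let P := max b.2.1 b.2.2
  (S * (S + b.2.1) ^ d / (S + 2 * b.2.1) ^ d,
   S * (S * S + b.1 * S + b.1 * b.2.2) ^ d / (S * (S + 2 * b.1)) ^ d + 1,
   min S (S * (P * (S * S + b.2.2 * S + b.2.2 * b.2.2)) ^ d /
     (S * (S * S + P * S + P * b.2.2)) ^ d + 1))

/-- Membership in the box with the bounds `b`, in units of `1 / S`. -/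
def InScaledBox (S : ℕ) (b : ℕ × ℕ × ℕ) (r : ℕ → ℝ) : Prop :=
  InBox ((b.1 : ℝ) / S) ((b.2.1 : ℝ) / S) ((b.2.2 : ℝ) / S) r

theorem floor_div_le_pow {S A B d : ℕ} (hS : 0 < S) :
    ((S * A ^ d / B ^ d : ℕ) : ℝ) / S ≤ ((A : ℝ) / B) ^ d := by
  have hS' : (0 : ℝ) < S := by exact_mod_cast hS
  rw [div_le_iff₀ hS', div_pow]
  refine (Nat.cast_div_le).trans ?_
  push_cast
  exact le_of_eq (by ring)

theorem pow_le_floor_div_add_one {S A B d : ℕ} (hS : 0 < S) :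
    ((A : ℝ) / B) ^ d ≤ ((S * A ^ d / B ^ d + 1 : ℕ) : ℝ) / S := by
  have hS' : (0 : ℝ) < S := by exact_mod_cast hS
  rw [le_div_iff₀ hS', div_pow]
  have h := (Nat.lt_floor_add_one (((S * A ^ d : ℕ) : ℝ) / ((B ^ d : ℕ) : ℝ))).le
  rw [Nat.floor_div_eq_div] at h
  push_cast at h ⊢
  refine le_trans (le_of_eq (by ring)) h

theorem InScaledBox.ratioMap {S d : ℕ} (hS : 0 < S) {b : ℕ × ℕ × ℕ} {r : ℕ → ℝ}
    (h : InScaledBox S b r) (ht : b.2.2 ≤ S) (hr : ∀ i, r i ≤ 1) :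
    InScaledBox S (boxStep S d b) (ratioMap d r) := by
  have hS' : (0 : ℝ) < S := by exact_mod_cast hS
  have hr' : ∀ i, LipschitzTree.ratioMap d r i ≤ 1 := fun i =>
    (ratioMap_mem (fun i => ⟨h.nonneg i, hr i⟩) i).2
  have ht' : (b.2.2 : ℝ) / S ≤ 1 := by
    rw [div_le_one hS']; exact_mod_cast ht
  have key := InBox.ratioMap h d (by positivity) ht'
  refine ⟨key.nonneg, ?_, ?_, fun i => ?_⟩
  · refine le_trans ?_ key.le_zero
    refine (floor_div_le_pow hS).trans (le_of_eq ?_)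
    unfold rootFactor
    congr 1
    push_cast
    field_simp
    ring
  · refine key.zero_le.trans ?_
    refine le_trans (le_of_eq ?_) (pow_le_floor_div_add_one hS)
    unfold rootFactor
    congr 1
    push_cast
    field_simp
  · have h1 := key.succ_le i
    have h2 : ratioFactor (max ((b.2.1 : ℝ) / S) ((b.2.2 : ℝ) / S)) ((b.2.2 : ℝ) / S)
        ((b.2.2 : ℝ) / S) ^ d ≤ ((S * (max b.2.1 b.2.2 *
          (S * S + b.2.2 * S + b.2.2 * b.2.2)) ^ d /
          (S * (S * S + max b.2.1 b.2.2 * S + max b.2.1 b.2.2 * b.2.2)) ^ d + 1 : ℕ) : ℝ) / S := by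
      refine le_trans (le_of_eq ?_) (pow_le_floor_div_add_one hS)
      rw [max_div_div_right hS'.le, ← Nat.cast_max]
      unfold ratioFactor
      congr 1
      push_cast
      field_simp
    rw [le_div_iff₀ hS'] at h2 ⊢
    simp only [boxStep, Nat.cast_min]
    -- Capping at `S` is harmless, as ratios never exceed `1`, and it secures the condition `t ≤ 1`
    -- for the next step.
    refine le_min ?_ ?_
    · nlinarith [hr' (i + 1)]
    · exact (mul_le_mul_of_nonneg_right h1 hS'.le).trans h2

theorem boxStep_le {S d : ℕ} (b : ℕ × ℕ × ℕ) : (boxStep S d b).2.2 ≤ S := min_le_left _ _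

theorem eventually_inScaledBox {S d : ℕ} (hS : 0 < S) {b : ℕ × ℕ × ℕ} {r : ℕ → ℝ}
    (hr : ∀ i, r i ∈ Set.Icc (0 : ℝ) 1) (ht : b.2.2 ≤ S)
    (h : ∀ᶠ n in atTop, InScaledBox S b ((ratioMap d)^[n] r)) (N : ℕ) :
    ∀ᶠ n in atTop, InScaledBox S ((boxStep S d)^[N] b) ((ratioMap d)^[n] r) := by
  induction N generalizing b with
  | zero => exact h
  | succ N ih =>
    refine ih (boxStep_le b) ?_
    obtain ⟨n₀, hn₀⟩ := eventually_atTop.1 h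
    refine eventually_atTop.2 ⟨n₀ + 1, fun n hn => ?_⟩
    obtain ⟨n, rfl⟩ := Nat.exists_eq_add_one_of_ne_zero (by omega : n ≠ 0)
    rw [Function.iterate_succ_apply']
    exact (hn₀ n (by omega)).ratioMap hS ht fun i => (iterate_ratioMap_mem hr n i).2

/-! ### Contraction in a small box -/

/-- An exact difference identity, changing one variable at a time, replaces the mean value theorem;
each coefficient is then bounded over the box. -/
theorem abs_rootFactor_sub_le {m M a b a' b' : ℝ} (hm : 0 ≤ m) (ha : m ≤ a) (haM : a ≤ M)
    (ha' : m ≤ a') (hb' : b' ∈ Set.Icc (0 : ℝ) 1) :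
    |rootFactor a b - rootFactor a' b'| ≤
      1 / (1 + 2 * m) ^ 2 * |a - a'| + M / (1 + 2 * M) * |b - b'| := by
  have ha0 := hm.trans ha
  have ha0' := hm.trans ha'
  have hM := ha0.trans haM
  have key : rootFactor a b - rootFactor a' b' =
      -((1 - b') / ((1 + 2 * a) * (1 + 2 * a'))) * (a - a') + a / (1 + 2 * a) * (b - b') := by
    unfold rootFactor
    field_simp
    ring
  rw [key]
  refine (abs_add_le _ _).trans ?_
  rw [abs_mul, abs_mul, abs_neg, abs_of_nonneg (a := a / (1 + 2 * a)) (by positivity),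
    abs_of_nonneg (a := (1 - b') / _) (div_nonneg (sub_nonneg.2 hb'.2) (by positivity))]
  refine add_le_add (mul_le_mul_of_nonneg_right ?_ (abs_nonneg _))
    (mul_le_mul_of_nonneg_right ?_ (abs_nonneg _))
  · rw [sq]
    gcongr
    linarith [hb'.1]
  · rw [div_le_div_iff₀ (by positivity) (by positivity)]
    nlinarith

theorem abs_ratioFactor_sub_le {m P t p q s p' q' s' : ℝ} (hm : 0 ≤ m) (hP1 : P ≤ 1)
    (hp : p ∈ Set.Icc m P) (hp' : p' ∈ Set.Icc m P) (hq : q ∈ Set.Icc 0 t)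
    (hq' : q' ∈ Set.Icc 0 t) (hs : s ∈ Set.Icc 0 t) :
    |ratioFactor p q s - ratioFactor p' q' s'| ≤
      (1 + t + t * t) / (1 + m) ^ 2 * |p - p'| +
        (P / (1 + P) ^ 2 + t * P / (1 + P)) * |q - q'| + t * P / (1 + P) * |s - s'| := by
  obtain ⟨hp1, hp2⟩ := hp
  obtain ⟨hp1', hp2'⟩ := hp'
  obtain ⟨hq1, hq2⟩ := hq
  obtain ⟨hq1', hq2'⟩ := hq'
  obtain ⟨hs1, hs2⟩ := hs
  have hp0 := hm.trans hp1
  have hp0' := hm.trans hp1'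
  have hP := hp0.trans hp2
  have ht := hq1.trans hq2
  have hdiv : p' / (1 + p') ≤ P / (1 + P) := by
    rw [div_le_div_iff₀ (by positivity) (by positivity)]; nlinarith
  -- `x / (1 + x)²` increases only up to `x = 1`, hence the condition `P ≤ 1`.
  have hdiv2 : p' / (1 + p') ^ 2 ≤ P / (1 + P) ^ 2 := by
    rw [div_le_div_iff₀ (by positivity) (by positivity)]
    have : 0 ≤ (P - p') * (1 - p' * P) :=
      mul_nonneg (by linarith) (by nlinarith)
    linarith
  have key : ratioFactor p q s - ratioFactor p' q' s' =
      (1 + q + q * s) / ((1 + p + p * q) * (1 + p' + p' * q)) * (p - p') +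
      p' * (1 + s + s * p') / ((1 + p' + p' * q) * (1 + p' + p' * q')) * (q - q') +
      p' * q' / (1 + p' + p' * q') * (s - s') := by
    unfold ratioFactor
    have h1 : 1 + p + p * q ≠ 0 := by positivity
    have h2 : 1 + p' + p' * q ≠ 0 := by positivity
    have h3 : 1 + p' + p' * q' ≠ 0 := by positivity
    field_simp
    ring
  have hpq := mul_nonneg hp0 hq1
  have hpq2 := mul_nonneg hp0' hq1
  have hpq3 := mul_nonneg hp0' hq1'
  rw [key]
  refine (abs_add_three _ _ _).trans ?_
  rw [abs_mul, abs_mul, abs_mul, abs_of_nonneg (a := p' * q' / _) (by positivity),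
    abs_of_nonneg (a := (1 + q + q * s) / _) (by positivity),
    abs_of_nonneg (a := p' * (1 + s + s * p') / _) (by positivity)]
  refine add_le_add_three (mul_le_mul_of_nonneg_right ?_ (abs_nonneg _))
    (mul_le_mul_of_nonneg_right ?_ (abs_nonneg _)) (mul_le_mul_of_nonneg_right ?_ (abs_nonneg _))
  · rw [sq]
    refine div_le_div₀ (by positivity) (by gcongr) (by positivity) ?_
    exact mul_le_mul (by linarith) (by linarith) (by positivity) (by positivity)
  · calc p' * (1 + s + s * p') / ((1 + p' + p' * q) * (1 + p' + p' * q'))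
        ≤ p' * (1 + t + t * p') / ((1 + p') * (1 + p')) := by
          refine div_le_div₀ (by positivity) (by gcongr) (by positivity) ?_
          exact mul_le_mul (by linarith) (by linarith) (by positivity) (by positivity)
      _ = p' / (1 + p') ^ 2 + t * (p' / (1 + p')) := by field_simp; ring
      _ ≤ P / (1 + P) ^ 2 + t * (P / (1 + P)) := by gcongr
      _ = _ := by ring
  · calc p' * q' / (1 + p' + p' * q') ≤ p' * t / (1 + p') := by
          exact div_le_div₀ (by positivity) (by gcongr) (by positivity) (by linarith)
      _ = t * (p' / (1 + p')) := by ring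
      _ ≤ t * (P / (1 + P)) := by gcongr
      _ = _ := by ring

theorem abs_pow_sub_pow_le_of_le {x y X : ℝ} (hx : 0 ≤ x) (hy : 0 ≤ y) (hxX : x ≤ X) (hyX : y ≤ X)
    (d : ℕ) : |x ^ d - y ^ d| ≤ d * X ^ (d - 1) * |x - y| := by
  refine (abs_pow_sub_pow_le x y d).trans ?_
  rw [abs_of_nonneg hx, abs_of_nonneg hy, mul_assoc, mul_comm]
  gcongr
  exact max_le hxX hyX

/-- Numerical conditions under which `ratioMap d` contracts by the factor `θ`, on the box with
bounds `m, M, t`, in the norm that gives weight `1 / K` to the first coordinate. -/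
structure ContractionBounds (d : ℕ) (K θ m M t : ℝ) : Prop where
  K_nonneg : 0 ≤ K
  m_nonneg : 0 ≤ m
  M_le : M ≤ 1
  t_le_M : t ≤ M
  root : d * rootFactor m t ^ (d - 1) * (1 / (1 + 2 * m) ^ 2 * K + M / (1 + 2 * M)) ≤ θ * K
  first : d * ratioFactor M t t ^ (d - 1) * ((1 + t + t * t) / (1 + m) ^ 2 * K +
    (M / (1 + M) ^ 2 + t * M / (1 + M)) + t * M / (1 + M)) ≤ θ
  -- Away from the root the only lower bound on the ratios is `0`, which takes the place of `m`.
  tail : d * ratioFactor t t t ^ (d - 1) * ((1 + t + t * t) / (1 + 0) ^ 2 +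
    (t / (1 + t) ^ 2 + t * t / (1 + t)) + t * t / (1 + t)) ≤ θ

theorem ContractionBounds.abs_ratioMap_sub_le {d : ℕ} {K θ m M t : ℝ}
    (hb : ContractionBounds d K θ m M t) {r r' : ℕ → ℝ} (hr : InBox m M t r)
    (hr' : InBox m M t r') {δ : ℝ} (h0 : |r 0 - r' 0| ≤ K * δ)
    (h : ∀ i, |r (i + 1) - r' (i + 1)| ≤ δ) :
    |ratioMap d r 0 - ratioMap d r' 0| ≤ K * (θ * δ) ∧
      ∀ i, |ratioMap d r (i + 1) - ratioMap d r' (i + 1)| ≤ θ * δ := by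
  have hm := hb.m_nonneg
  have hδ : 0 ≤ δ := (abs_nonneg _).trans (h 0)
  have ht : 0 ≤ t := (hr.nonneg 1).trans (hr.succ_le 0)
  have ht1 : t ≤ 1 := hb.t_le_M.trans hb.M_le
  have hM : 0 ≤ M := ht.trans hb.t_le_M
  have mem : ∀ i, r (i + 1) ∈ Set.Icc 0 t := fun i => ⟨hr.nonneg _, hr.succ_le i⟩
  have mem' : ∀ i, r' (i + 1) ∈ Set.Icc 0 t := fun i => ⟨hr'.nonneg _, hr'.succ_le i⟩
  refine ⟨?_, fun i => ?_⟩
  · refine (abs_pow_sub_pow_le_of_le (rootFactor_nonneg (hr.nonneg _) (hr.nonneg _))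
      (rootFactor_nonneg (hr'.nonneg _) (hr'.nonneg _))
      (rootFactor_le hm hr.le_zero (hr.succ_le 0) ht1)
      (rootFactor_le hm hr'.le_zero (hr'.succ_le 0) ht1) d).trans ?_
    have hX := rootFactor_nonneg hm ht
    calc _ ≤ d * rootFactor m t ^ (d - 1) *
          (1 / (1 + 2 * m) ^ 2 * (K * δ) + M / (1 + 2 * M) * δ) := by
          refine mul_le_mul_of_nonneg_left ?_ (by positivity)
          refine (abs_rootFactor_sub_le hm hr.le_zero hr.zero_le hr'.le_zero
            ⟨hr'.nonneg _, (hr'.succ_le 0).trans ht1⟩).trans ?_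
          have := h 0
          gcongr
      _ = d * rootFactor m t ^ (d - 1) *
          (1 / (1 + 2 * m) ^ 2 * K + M / (1 + 2 * M)) * δ := by ring
      _ ≤ θ * K * δ := mul_le_mul_of_nonneg_right hb.root hδ
      _ = _ := by ring
  · have hpow : ∀ X, ratioFactor (r i) (r (i + 1)) (r (i + 2)) ≤ X →
        ratioFactor (r' i) (r' (i + 1)) (r' (i + 2)) ≤ X → |ratioMap d r (i + 1) -
        ratioMap d r' (i + 1)| ≤ d * X ^ (d - 1) * |ratioFactor (r i) (r (i + 1)) (r (i + 2)) -
          ratioFactor (r' i) (r' (i + 1)) (r' (i + 2))| := fun X hX hX' =>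
      abs_pow_sub_pow_le_of_le (ratioFactor_nonneg (hr.nonneg _) (hr.nonneg _) (hr.nonneg _))
        (ratioFactor_nonneg (hr'.nonneg _) (hr'.nonneg _) (hr'.nonneg _)) hX hX' d
    cases i with
    | zero =>
      refine (hpow (ratioFactor M t t)
        (ratioFactor_mono (hr.nonneg _) (hr.nonneg _) (hr.nonneg _) hr.zero_le (hr.succ_le _)
          (hr.succ_le _))
        (ratioFactor_mono (hr'.nonneg _) (hr'.nonneg _) (hr'.nonneg _) hr'.zero_le
          (hr'.succ_le _) (hr'.succ_le _))).trans ?_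
      have hX := ratioFactor_nonneg hM ht ht
      calc _ ≤ d * ratioFactor M t t ^ (d - 1) * ((1 + t + t * t) / (1 + m) ^ 2 * (K * δ) +
            (M / (1 + M) ^ 2 + t * M / (1 + M)) * δ + t * M / (1 + M) * δ) := by
            refine mul_le_mul_of_nonneg_left ?_ (by positivity)
            refine (abs_ratioFactor_sub_le hm hb.M_le ⟨hr.le_zero, hr.zero_le⟩
              ⟨hr'.le_zero, hr'.zero_le⟩ (mem 0) (mem' 0) (mem 1)).trans ?_
            have h1 := h 0
            have h2 := h 1
            gcongr
        _ = d * ratioFactor M t t ^ (d - 1) * ((1 + t + t * t) / (1 + m) ^ 2 * K +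
            (M / (1 + M) ^ 2 + t * M / (1 + M)) + t * M / (1 + M)) * δ := by ring
        _ ≤ θ * δ := mul_le_mul_of_nonneg_right hb.first hδ
    | succ i =>
      refine (hpow (ratioFactor t t t)
        (ratioFactor_mono (hr.nonneg _) (hr.nonneg _) (hr.nonneg _) (hr.succ_le _) (hr.succ_le _)
          (hr.succ_le _))
        (ratioFactor_mono (hr'.nonneg _) (hr'.nonneg _) (hr'.nonneg _) (hr'.succ_le _)
          (hr'.succ_le _) (hr'.succ_le _))).trans ?_
      have hX := ratioFactor_nonneg ht ht ht
      calc _ ≤ d * ratioFactor t t t ^ (d - 1) * ((1 + t + t * t) / (1 + 0) ^ 2 * δ +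
            (t / (1 + t) ^ 2 + t * t / (1 + t)) * δ + t * t / (1 + t) * δ) := by
            refine mul_le_mul_of_nonneg_left ?_ (by positivity)
            refine (abs_ratioFactor_sub_le le_rfl ht1 (mem _) (mem' _) (mem _) (mem' _)
              (mem _)).trans ?_
            have h0 := h i
            have h1 := h (i + 1)
            have h2 := h (i + 2)
            gcongr
        _ = d * ratioFactor t t t ^ (d - 1) * ((1 + t + t * t) / (1 + 0) ^ 2 +
            (t / (1 + t) ^ 2 + t * t / (1 + t)) + t * t / (1 + t)) * δ := by ring
        _ ≤ θ * δ := mul_le_mul_of_nonneg_right hb.tail hδ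

theorem ContractionBounds.abs_iterate_sub_le {d : ℕ} {K θ m M t : ℝ}
    (hb : ContractionBounds d K θ m M t) (hK : 1 ≤ K) {r r' : ℕ → ℝ}
    (hr : ∀ n, InBox m M t ((ratioMap d)^[n] r)) (hr' : ∀ n, InBox m M t ((ratioMap d)^[n] r'))
    (n i : ℕ) : |(ratioMap d)^[n] r i - (ratioMap d)^[n] r' i| ≤ K * θ ^ n := by
  have ht1 : t ≤ 1 := hb.t_le_M.trans hb.M_le
  have key : |(ratioMap d)^[n] r 0 - (ratioMap d)^[n] r' 0| ≤ K * θ ^ n ∧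
      ∀ i, |(ratioMap d)^[n] r (i + 1) - (ratioMap d)^[n] r' (i + 1)| ≤ θ ^ n := by
    induction n with
    | zero =>
      have a1 : ∀ x y : ℝ, 0 ≤ x → x ≤ 1 → 0 ≤ y → y ≤ 1 → |x - y| ≤ 1 := fun x y _ _ _ _ =>
        abs_le.2 ⟨by linarith, by linarith⟩
      simp only [pow_zero, mul_one]
      exact ⟨(a1 _ _ ((hr 0).nonneg 0) ((hr 0).zero_le.trans hb.M_le) ((hr' 0).nonneg 0)
        ((hr' 0).zero_le.trans hb.M_le)).trans hK, fun i => a1 _ _ ((hr 0).nonneg _)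
        (((hr 0).succ_le i).trans ht1) ((hr' 0).nonneg _) (((hr' 0).succ_le i).trans ht1)⟩
    | succ n ih =>
      simp only [Function.iterate_succ_apply', pow_succ']
      exact hb.abs_ratioMap_sub_le (hr n) (hr' n) ih.1 ih.2
  cases i with
  | zero => exact key.1
  | succ i =>
    have hθ : 0 ≤ θ ^ n := (abs_nonneg _).trans (key.2 i)
    exact (key.2 i).trans (le_mul_of_one_le_left hθ hK)

/-- Sequences of ratios of good weights. -/
def IsGoodRatio (r : ℕ → ℝ) : Prop :=
  (∀ i, r i ∈ Set.Icc (0 : ℝ) 1) ∧ ∃ k : ℕ, ∃ c < 1, ∀ i, k ≤ i → r i ≤ c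

/-- The orbit of the zero sequence, the ratios of a point mass at `0`, is compared with its own
shift, hence is Cauchy and converges to a fixed point. Every other orbit is then compared with the
constant orbit of that fixed point. -/
theorem ContractionBounds.exists_limit {d : ℕ} {K θ m M t : ℝ}
    (hb : ContractionBounds d K θ m M t) (hK : 1 ≤ K) (hθ0 : 0 ≤ θ) (hθ : θ < 1)
    (hbox : ∀ r, IsGoodRatio r → ∀ᶠ n in atTop, InBox m M t ((ratioMap d)^[n] r)) :
    ∃ ρ, InBox m M t ρ ∧ ratioMap d ρ = ρ ∧
      ∀ r, IsGoodRatio r → ∀ i, Tendsto (fun n => (ratioMap d)^[n] r i) atTop (𝓝 (ρ i)) := by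
  have shift : ∀ r, IsGoodRatio r → ∃ N, ∀ n, InBox m M t ((ratioMap d)^[n]
      ((ratioMap d)^[N] r)) := by
    intro r hr
    obtain ⟨N, hN⟩ := eventually_atTop.1 (hbox r hr)
    refine ⟨N, fun n => ?_⟩
    rw [← Function.iterate_add_apply]
    exact hN _ (by omega)
  obtain ⟨N, hN⟩ := shift (fun _ => 0) ⟨fun _ => by simp, 0, 0, by norm_num, by simp⟩
  set r₀ := (ratioMap d)^[N] fun _ => 0 with hr₀
  have hcauchy : ∀ i, ∃ x, Tendsto (fun n => (ratioMap d)^[n] r₀ i) atTop (𝓝 x) := fun i => by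
    refine cauchySeq_tendsto_of_complete (cauchySeq_of_le_geometric θ K hθ fun n => ?_)
    rw [Real.dist_eq, Function.iterate_succ_apply]
    refine hb.abs_iterate_sub_le hK hN (fun n => ?_) n i
    rw [← Function.iterate_succ_apply]
    exact hN _
  choose ρ hρ using hcauchy
  have hρbox : InBox m M t ρ :=
    ⟨fun i => ge_of_tendsto' (hρ i) fun n => (hN n).nonneg i,
      ge_of_tendsto' (hρ 0) fun n => (hN n).le_zero,
      le_of_tendsto' (hρ 0) fun n => (hN n).zero_le,
      fun i => le_of_tendsto' (hρ _) fun n => (hN n).succ_le i⟩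
  have hfix : ratioMap d ρ = ρ := by
    ext i
    refine tendsto_nhds_unique (tendsto_ratioMap_apply hρbox.nonneg hρ i) ?_
    simpa only [Function.comp_def, Function.iterate_succ_apply'] using (hρ i).comp (tendsto_add_atTop_nat 1)
  refine ⟨ρ, hρbox, hfix, fun r hr i => ?_⟩
  obtain ⟨N', hN'⟩ := shift r hr
  rw [← tendsto_add_atTop_iff_nat N', tendsto_iff_dist_tendsto_zero]
  have hlim : Tendsto (fun n : ℕ => K * θ ^ n) atTop (𝓝 0) := by
    simpa using (tendsto_pow_atTop_nhds_zero_of_lt_one hθ0 hθ).const_mul K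
  refine squeeze_zero (fun _ => dist_nonneg) (fun n => ?_) hlim
  have h := hb.abs_iterate_sub_le hK hN' (r' := ρ) (fun n => by
    rwa [Function.iterate_fixed hfix]) n i
  rw [Function.iterate_fixed hfix] at h
  rwa [Real.dist_eq, Function.iterate_add_apply]

theorem exists_limit_ratio_of_iterate {d N : ℕ} (hd : 2 ≤ d) {K : ℝ} {b : ℕ × ℕ × ℕ}
    (hK : 1 ≤ K) (hN : (boxStep 1000000 d)^[N] (0, 1000000, 500000) = b)
    (hb : ContractionBounds d K (99 / 100) ((b.1 : ℝ) / (1000000 : ℕ))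
      ((b.2.1 : ℝ) / (1000000 : ℕ)) ((b.2.2 : ℝ) / (1000000 : ℕ))) :
    ∃ ρ : ℕ → ℝ, (∀ i, ρ i ∈ Set.Icc (0 : ℝ) 1) ∧ ratioMap d ρ = ρ ∧ IsGoodRatio ρ ∧
      ∀ r, IsGoodRatio r → ∀ i, Tendsto (fun n => (ratioMap d)^[n] r i) atTop (𝓝 (ρ i)) := by
  obtain ⟨ρ, hbox, hfix, hlim⟩ := hb.exists_limit hK (by norm_num) (by norm_num) fun r hr => by
    obtain ⟨hr, k, c, hc, h⟩ := hr
    rw [← hN]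
    refine eventually_inScaledBox (by norm_num) hr (by norm_num) ?_ N
    filter_upwards [eventually_iterate_ratioMap_le_half hd hr hc h] with n hn
    have hmem := iterate_ratioMap_mem (d := d) hr n
    refine ⟨fun i => (hmem i).1, ?_, ?_, fun i => ?_⟩
    · simpa using (hmem 0).1
    · simpa using (hmem 0).2
    · exact (hn i).trans (by norm_num)
  have hzero : IsGoodRatio fun _ => 0 := ⟨fun _ => by simp, 0, 0, by norm_num, by simp⟩
  have hmem : ∀ i, ρ i ∈ Set.Icc (0 : ℝ) 1 := fun i =>
    isClosed_Icc.mem_of_tendsto (hlim _ hzero i)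
      (Eventually.of_forall fun n => iterate_ratioMap_mem hzero.1 n i)
  refine ⟨ρ, hmem, hfix, ⟨hmem, 1, 1 / 2, by norm_num, fun i hi => ?_⟩, hlim⟩
  obtain ⟨j, rfl⟩ : ∃ j, i = j + 1 := ⟨i - 1, by omega⟩
  refine le_of_tendsto (hlim _ hzero (j + 1)) ?_
  filter_upwards [eventually_iterate_ratioMap_le_half (k := 0) hd hzero.1
    (zero_lt_one : (0 : ℝ) < 1) (by simp)] with n hn using hn j

/-- For `2 ≤ d ≤ 7` the ratios of all good weights converge to the same fixed point. -/
theorem exists_limit_ratio {d : ℕ} (hd : 2 ≤ d) (hd' : d ≤ 7) :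
    ∃ ρ : ℕ → ℝ, (∀ i, ρ i ∈ Set.Icc (0 : ℝ) 1) ∧ ratioMap d ρ = ρ ∧ IsGoodRatio ρ ∧
      ∀ r, IsGoodRatio r → ∀ i, Tendsto (fun n => (ratioMap d)^[n] r i) atTop (𝓝 (ρ i)) := by
  -- In each case `b` is the box after `N` integer steps. A larger `K` damps the influence of `r 1`
  -- on `r 0`; as `d` grows, the root slope nears `-1`, which leaves less room and makes the boxes
  -- shrink more slowly, so both `K` and `N` become large at `d = 7`.
  interval_cases d
  · refine exists_limit_ratio_of_iterate (N := 10) (K := 1) (b := (516465, 639550, 205954))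
      le_rfl (by norm_num) (by decide +kernel) ?_
    constructor <;> norm_num [rootFactor, ratioFactor]
  · refine exists_limit_ratio_of_iterate (N := 8) (K := 2) (b := (430595, 471705, 36951))
      (by norm_num) (by norm_num) (by decide +kernel) ?_
    constructor <;> norm_num [rootFactor, ratioFactor]
  · refine exists_limit_ratio_of_iterate (N := 8) (K := 2) (b := (359178, 397247, 7407))
      (by norm_num) (by norm_num) (by decide +kernel) ?_
    constructor <;> norm_num [rootFactor, ratioFactor]
  · refine exists_limit_ratio_of_iterate (N := 13) (K := 5) (b := (320400, 342153, 1097))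
      (by norm_num) (by norm_num) (by decide +kernel) ?_
    constructor <;> norm_num [rootFactor, ratioFactor]
  · refine exists_limit_ratio_of_iterate (N := 25) (K := 10) (b := (286789, 300774, 154))
      (by norm_num) (by norm_num) (by decide +kernel) ?_
    constructor <;> norm_num [rootFactor, ratioFactor]
  · refine exists_limit_ratio_of_iterate (N := 90) (K := 100) (b := (260801, 268216, 20))
      (by norm_num) (by norm_num) (by decide +kernel) ?_
    constructor <;> norm_num [rootFactor, ratioFactor]

/-! ### Summing over the leaves -/

instance finite_ball (d n : ℕ) : Finite (ball d n) := List.finite_length_le (Fin d) n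

/-- Restriction to a smaller ball. -/
def restrictLE {d r n : ℕ} (h : r ≤ n) (f : Config d n) : Config d r :=
  fun v => f ⟨v.1, le_trans v.2 h⟩

theorem measurable_restrictLE {d r n : ℕ} (h : r ≤ n) :
    Measurable (restrictLE h : Config d n → Config d r) :=
  measurable_pi_lambda _ fun _ => measurable_pi_apply _

theorem isLipschitz_finiteTree_iff {d n : ℕ} {f : Config d n} :
    IsLipschitz (finiteTree d n) f ↔ ∀ (a : Fin d) (u : List (Fin d)) (h : (a :: u).length ≤ n),
      |f ⟨a :: u, h⟩ - f ⟨u, (Nat.le_succ _).trans h⟩| ≤ 1 := by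
  constructor
  · intro hf a u h
    refine hf _ _ ?_
    simp [finiteTree, daryTree, SimpleGraph.fromRel_adj]
  · rintro hf ⟨u, hu⟩ ⟨v, hv⟩ huv
    simp only [finiteTree, daryTree, SimpleGraph.comap_adj, SimpleGraph.fromRel_adj,
      Function.Embedding.subtype_apply] at huv
    rcases huv.2 with ⟨a, rfl⟩ | ⟨a, rfl⟩
    · rw [abs_sub_comm]; exact hf a u hv
    · exact hf a v hu

/-- The values on the ball of radius `n` and on the leaves determine a function on the tree of
height `n + 1`. -/
def configSuccEquiv (d n : ℕ) :
    Config d (n + 1) ≃ Config d n × (List.Vector (Fin d) (n + 1) → ℤ) where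
  toFun f := (restrictLE n.le_succ f, fun v => f (leaf v))
  invFun p v := if h : v.1.length ≤ n then p.1 ⟨v.1, h⟩ else
    p.2 ⟨v.1, le_antisymm v.2 (not_le.1 h)⟩
  left_inv f := by
    funext v
    simp only [restrictLE, leaf]
    split_ifs <;> rfl
  right_inv p := by
    refine Prod.ext (funext fun v => dif_pos v.2) (funext fun v => ?_)
    exact dif_neg (by simp [leaf, v.2])

theorem isLipschitz_succ_iff {d n : ℕ} {f : Config d (n + 1)} :
    IsLipschitz (finiteTree d (n + 1)) f ↔ IsLipschitz (finiteTree d n) (restrictLE n.le_succ f) ∧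
      ∀ v : List.Vector (Fin d) (n + 1),
        |f (leaf v) - restrictLE n.le_succ f (leaf v.tail)| ≤ 1 := by
  simp only [isLipschitz_finiteTree_iff]
  constructor
  · refine fun hf => ⟨fun a u h => hf a u (h.trans n.le_succ), fun v => ?_⟩
    obtain ⟨a, u, rfl⟩ := v.exists_eq_cons
    exact hf a u.1 (by simp [u.2])
  · rintro ⟨h1, h2⟩ a u h
    rcases h.lt_or_eq with hlt | heq
    · exact h1 a u (Nat.lt_succ_iff.1 hlt)
    · exact h2 ⟨a :: u, heq⟩

/-- The action on weights of one level of the `d`-ary tree. -/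
def stepWeight (d : ℕ) (w : ℤ → ℝ≥0) (i : ℤ) : ℝ≥0 := (w (i - 1) + w i + w (i + 1)) ^ d

theorem tsum_pi_prod {ι : Type*} [Fintype ι] [DecidableEq ι] {φ : ι → ℤ → ℝ≥0∞} (t : ι → Finset ℤ)
    (h : ∀ v, ∀ j ∉ t v, φ v j = 0) :
    ∑' x : ι → ℤ, ∏ v, φ v (x v) = ∏ v, ∑' j, φ v j := by
  rw [tsum_eq_sum (s := Fintype.piFinset t), Finset.prod_congr rfl fun v _ =>
    tsum_eq_sum (s := t v) (h v), Finset.prod_univ_sum]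
  intro x hx
  obtain ⟨v, hv⟩ : ∃ v, x v ∉ t v := by simpa [Fintype.mem_piFinset] using hx
  exact Finset.prod_eq_zero (Finset.mem_univ v) (h v _ hv)

theorem tsum_near (w : ℤ → ℝ≥0) (i : ℤ) :
    ∑' j, (if |j - i| ≤ 1 then (w j : ℝ≥0∞) else 0) =
      ((w (i - 1) + w i + w (i + 1) : ℝ≥0) : ℝ≥0∞) := by
  rw [tsum_eq_sum (s := {i - 1, i, i + 1})]
  · rw [Finset.sum_insert (by simp; omega), Finset.sum_insert (by simp), Finset.sum_singleton]
    simp [add_assoc]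
  · intro j hj
    rw [if_neg]
    simp only [Finset.mem_insert, Finset.mem_singleton, not_or] at hj
    rw [abs_le]
    omega

theorem prod_vector_succ {M : Type*} [CommMonoid M] {d n : ℕ}
    (F : List.Vector (Fin d) n → M) :
    ∏ v : List.Vector (Fin d) (n + 1), F v.tail = ∏ u, F u ^ d := by
  let e : Fin d × List.Vector (Fin d) n ≃ List.Vector (Fin d) (n + 1) :=
    { toFun := fun p => p.1 ::ᵥ p.2
      invFun := fun v => (v.head, v.tail)
      left_inv := fun p => by simp
      right_inv := fun v => by simp }
  rw [← e.prod_comp, Fintype.prod_prod_type_right]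
  simp [e]

/-- With `g` fixed, the Lipschitz condition constrains each leaf only through its parent, so the sum
factorises over leaves. The `d` siblings give equal factors, whence the `d`-th power in
`stepWeight`. -/
theorem tsum_weight_extensions {d n : ℕ} (w : ℤ → ℝ≥0) (g : Config d n) :
    ∑' h, weight d (n + 1) w ((configSuccEquiv d n).symm (g, h)) =
      weight d n (stepWeight d w) g := by
  classical
  have key : ∀ h, weight d (n + 1) w ((configSuccEquiv d n).symm (g, h)) =
      (if IsLipschitz (finiteTree d n) g then 1 else 0) *
        ∏ v : List.Vector (Fin d) (n + 1),
          if |h v - g (leaf v.tail)| ≤ 1 then (w (h v) : ℝ≥0∞) else 0 := by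
    intro h
    set f := (configSuccEquiv d n).symm (g, h) with hf
    have h1 : restrictLE n.le_succ f = g :=
      congrArg Prod.fst ((configSuccEquiv d n).apply_symm_apply (g, h))
    have h2 : (fun v => f (leaf v)) = h :=
      congrArg Prod.snd ((configSuccEquiv d n).apply_symm_apply (g, h))
    have h3 := isLipschitz_succ_iff (f := f)
    rw [h1] at h3
    have h4 : ∀ v, f (leaf v) = h v := fun v => congrFun h2 v
    simp only [h4] at h3
    by_cases hg : IsLipschitz (finiteTree d n) g
    · by_cases hh : ∀ v : List.Vector (Fin d) (n + 1), |h v - g (leaf v.tail)| ≤ 1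
      · rw [weight, Set.indicator_of_mem (h3.2 ⟨hg, hh⟩), if_pos hg, one_mul]
        refine Finset.prod_congr rfl fun v _ => ?_
        rw [if_pos (hh v), h4]
      · rw [weight, Set.indicator_of_notMem fun hm => hh (h3.1 hm).2]
        push Not at hh
        obtain ⟨v, hv⟩ := hh
        rw [Finset.prod_eq_zero (Finset.mem_univ v) (if_neg (not_le.2 hv)), mul_zero]
    · rw [weight, Set.indicator_of_notMem fun hm => hg (h3.1 hm).1, if_neg hg, zero_mul]
  simp only [key]
  have hprod := tsum_pi_prod (φ := fun (v : List.Vector (Fin d) (n + 1)) j =>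
    if |j - g (leaf v.tail)| ≤ 1 then (w j : ℝ≥0∞) else 0)
    (fun v => Finset.Icc (g (leaf v.tail) - 1) (g (leaf v.tail) + 1))
  rw [ENNReal.tsum_mul_left, hprod]
  · simp only [tsum_near]
    rw [prod_vector_succ (fun u => ((w (g (leaf u) - 1) + w (g (leaf u)) +
      w (g (leaf u) + 1) : ℝ≥0) : ℝ≥0∞))]
    by_cases hg : IsLipschitz (finiteTree d n) g
    · rw [weight, Set.indicator_of_mem hg, if_pos hg, one_mul]
      simp [stepWeight]
    · rw [weight, Set.indicator_of_notMem hg, if_neg hg, zero_mul]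
  · intro v j hj
    rw [if_neg]
    rw [Finset.mem_Icc] at hj
    rw [abs_le]
    omega

theorem tsum_weight_mul_restrict {d n : ℕ} (w : ℤ → ℝ≥0) (φ : Config d n → ℝ≥0∞) :
    ∑' f, weight d (n + 1) w f * φ (restrictLE n.le_succ f) =
      ∑' g, weight d n (stepWeight d w) g * φ g := by
  rw [← (configSuccEquiv d n).symm.tsum_eq, ENNReal.tsum_prod']
  refine tsum_congr fun g => ?_
  rw [← tsum_weight_extensions, ← ENNReal.tsum_mul_right]
  refine tsum_congr fun h => ?_
  congr 2
  exact congrArg Prod.fst ((configSuccEquiv d n).apply_symm_apply (g, h))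

theorem tsum_weight_succ {d n : ℕ} (w : ℤ → ℝ≥0) :
    ∑' f, weight d (n + 1) w f = ∑' g, weight d n (stepWeight d w) g := by
  simpa using tsum_weight_mul_restrict (n := n) (d := d) w fun _ => 1

/-- The partition function is a sum over the value at the root. -/
theorem tsum_weight {d n : ℕ} (w : ℤ → ℝ≥0) :
    ∑' f, weight d n w f = ∑' i, (((stepWeight d)^[n] w i : ℝ≥0) : ℝ≥0∞) := by
  induction n generalizing w with
  | zero =>
    have hu : ∀ v w : ball d 0, v = w := fun v w => Subtype.ext <| by
      rw [List.eq_nil_of_length_eq_zero (Nat.le_zero.1 v.2),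
        List.eq_nil_of_length_eq_zero (Nat.le_zero.1 w.2)]
    let e : ℤ ≃ Config d 0 :=
      { toFun := fun i _ => i
        invFun := fun f => f ⟨[], Nat.zero_le 0⟩
        left_inv := fun i => rfl
        right_inv := fun f => funext fun v => congrArg f (hu _ _) }
    rw [← e.tsum_eq]
    refine tsum_congr fun i => ?_
    rw [weight, Set.indicator_of_mem (isLipschitz_finiteTree_iff.2 fun a u h => by simp [e])]
    have : Fintype.card (List.Vector (Fin d) 0) = 1 := by simp
    simp [e]
  | succ n ih => rw [tsum_weight_succ, ih, Function.iterate_succ_apply]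

theorem weightedLaw_apply {d n : ℕ} (w : ℤ → ℝ≥0) (A : Set (Config d n)) :
    weightedLaw d w n A = (∑' f, weight d n w f)⁻¹ * ∑' f, weight d n w f * A.indicator 1 f := by
  have hA : MeasurableSet A := A.to_countable.measurableSet
  rw [weightedLaw, Measure.smul_apply, Measure.sum_apply _ hA]
  simp [Measure.dirac_apply' _ hA]

theorem weightedLaw_singleton {d n : ℕ} (w : ℤ → ℝ≥0) (f : Config d n) :
    weightedLaw d w n {f} = (∑' f, weight d n w f)⁻¹ * weight d n w f := by
  rw [weightedLaw_apply]
  congr 1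
  rw [tsum_eq_single f fun g hg => by simp [hg]]
  simp

theorem map_weightedLaw_succ {d n : ℕ} (w : ℤ → ℝ≥0) :
    (weightedLaw d w (n + 1)).map (restrictLE n.le_succ) = weightedLaw d (stepWeight d w) n := by
  ext A hA
  rw [Measure.map_apply (measurable_restrictLE _) hA,
    weightedLaw_apply, weightedLaw_apply, tsum_weight_succ]
  congr 1
  exact tsum_weight_mul_restrict w (A.indicator 1)

theorem map_weightedLaw {d r n : ℕ} (h : r ≤ n) (w : ℤ → ℝ≥0) :
    (weightedLaw d w n).map (restrictLE h) = weightedLaw d ((stepWeight d)^[n - r] w) r := by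
  induction n, h using Nat.le_induction generalizing w with
  | base =>
    rw [Nat.sub_self]
    exact Measure.map_id
  | succ n h ih =>
    rw [Nat.succ_sub h, Function.iterate_succ_apply, ← ih, ← map_weightedLaw_succ,
      Measure.map_map (measurable_restrictLE _) (measurable_restrictLE _)]
    rfl

theorem weight_smul {d n : ℕ} (c : ℝ≥0) (w : ℤ → ℝ≥0) (f : Config d n) :
    weight d n (fun i => c * w i) f = (c : ℝ≥0∞) ^ d ^ n * weight d n w f := by
  by_cases hf : IsLipschitz (finiteTree d n) f
  · rw [weight, weight, Set.indicator_of_mem hf, Set.indicator_of_mem hf]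
    simp [Finset.prod_mul_distrib]
  · rw [weight, weight, Set.indicator_of_notMem hf, Set.indicator_of_notMem hf, mul_zero]

theorem weightedLaw_smul {d n : ℕ} {c : ℝ≥0} (hc : c ≠ 0) (w : ℤ → ℝ≥0) :
    weightedLaw d (fun i => c * w i) n = weightedLaw d w n := by
  have h0 : (c : ℝ≥0∞) ^ d ^ n ≠ 0 := pow_ne_zero _ (by simpa using hc)
  have ht : (c : ℝ≥0∞) ^ d ^ n ≠ ∞ := ENNReal.pow_ne_top ENNReal.coe_ne_top
  ext A -
  simp only [weightedLaw_apply, weight_smul, mul_assoc, ENNReal.tsum_mul_left]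
  rw [ENNReal.mul_inv (.inl h0) (.inl ht), mul_mul_mul_comm, ENNReal.inv_mul_cancel h0 ht, one_mul]

/-! ### Finiteness of the partition function -/

theorem tsum_stepWeight_ne_top {d : ℕ} (hd : d ≠ 0) {w : ℤ → ℝ≥0}
    (hw : ∑' i, (w i : ℝ≥0∞) ≠ ∞) : ∑' i, (stepWeight d w i : ℝ≥0∞) ≠ ∞ := by
  obtain ⟨d, rfl⟩ := Nat.exists_eq_succ_of_ne_zero hd
  set s : ℤ → ℝ≥0∞ := fun i => w (i - 1) + w i + w (i + 1) with hs
  have hsum : ∑' i, s i ≠ ∞ := by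
    have h1 : ∑' i, (w (i - 1) : ℝ≥0∞) = ∑' i, (w i : ℝ≥0∞) :=
      (Equiv.subRight (1 : ℤ)).tsum_eq fun i => (w i : ℝ≥0∞)
    have h2 : ∑' i, (w (i + 1) : ℝ≥0∞) = ∑' i, (w i : ℝ≥0∞) :=
      (Equiv.addRight (1 : ℤ)).tsum_eq fun i => (w i : ℝ≥0∞)
    rw [hs, ENNReal.tsum_add, ENNReal.tsum_add, h1, h2]
    simp [hw]
  -- Each term is at most the whole sum, so `∑ s ^ (d + 1) ≤ (∑ s) ^ d * ∑ s`.
  refine ne_top_of_le_ne_top (b := (∑' i, s i) ^ d * ∑' i, s i)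
    (ENNReal.mul_ne_top (ENNReal.pow_ne_top hsum) hsum) ?_
  rw [← ENNReal.tsum_mul_left]
  refine ENNReal.tsum_le_tsum fun i => ?_
  have hi : (stepWeight d.succ w i : ℝ≥0∞) = s i ^ d * s i := by
    simp [stepWeight, hs, pow_succ]
  rw [hi]
  gcongr
  exact ENNReal.le_tsum (f := s) i

theorem tsum_iterate_stepWeight_ne_top {d : ℕ} (hd : d ≠ 0) {w : ℤ → ℝ≥0}
    (hw : ∑' i, (w i : ℝ≥0∞) ≠ ∞) (n : ℕ) :
    ∑' i, ((stepWeight d)^[n] w i : ℝ≥0∞) ≠ ∞ := by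
  induction n generalizing w with
  | zero => exact hw
  | succ n ih => exact ih (tsum_stepWeight_ne_top hd hw)

theorem tsum_weight_ne_zero {d n : ℕ} {w : ℤ → ℝ≥0} (hw : 0 < w 0) :
    ∑' f, weight d n w f ≠ 0 := by
  refine (lt_of_lt_of_le ?_ (ENNReal.le_tsum (0 : Config d n))).ne'
  rw [weight, Set.indicator_of_mem (isLipschitz_finiteTree_iff.2 (by simp))]
  exact pos_iff_ne_zero.2 (Finset.prod_ne_zero_iff.2 fun v _ => by simpa using hw.ne')

theorem isProbabilityMeasure_weightedLaw {d n : ℕ} (hd : d ≠ 0) {w : ℤ → ℝ≥0} (h0 : 0 < w 0)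
    (hw : ∑' i, (w i : ℝ≥0∞) ≠ ∞) : IsProbabilityMeasure (weightedLaw d w n) := by
  refine ⟨?_⟩
  rw [weightedLaw_apply]
  simp only [Set.indicator_univ, Pi.one_apply, mul_one]
  refine ENNReal.inv_mul_cancel (tsum_weight_ne_zero h0) ?_
  rw [tsum_weight]
  exact tsum_iterate_stepWeight_ne_top hd hw n

/-! ### Convergence of the laws on a ball -/

/-- By `tsum_weight` these sums are partition functions. One step preserves pointwise convergence
and domination, with `B` replaced by `stepWeight d B`, so everything reduces to dominated
convergence for counting measure. -/
theorem tendsto_tsum_iterate_stepWeight {d : ℕ} (hd : d ≠ 0) {u : ℕ → ℤ → ℝ≥0} {W B : ℤ → ℝ≥0}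
    (hu : ∀ i, Tendsto (fun n => u n i) atTop (𝓝 (W i))) (huB : ∀ᶠ n in atTop, ∀ i, u n i ≤ B i)
    (hB : ∑' i, (B i : ℝ≥0∞) ≠ ∞) (r : ℕ) :
    Tendsto (fun n => ∑' i, ((stepWeight d)^[r] (u n) i : ℝ≥0∞)) atTop
      (𝓝 (∑' i, ((stepWeight d)^[r] W i : ℝ≥0∞))) := by
  induction r generalizing u W B with
  | zero =>
    simp only [Function.iterate_zero, id_eq, ← lintegral_count]
    refine tendsto_lintegral_filter_of_dominated_convergence (fun i => (B i : ℝ≥0∞))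
      (Eventually.of_forall fun n => measurable_of_countable _) ?_ ?_ ?_
    · filter_upwards [huB] with n hn
      exact Eventually.of_forall fun i => by exact_mod_cast hn i
    · rwa [lintegral_count]
    · exact Eventually.of_forall fun i => ENNReal.tendsto_coe.2 (hu i)
  | succ r ih =>
    refine ih (fun i => (((hu (i - 1)).add (hu i)).add (hu (i + 1))).pow d) ?_
      (tsum_stepWeight_ne_top hd hB)
    filter_upwards [huB] with n hn i
    unfold stepWeight
    gcongr <;> exact hn _

theorem tendsto_weight {d r : ℕ} {u : ℕ → ℤ → ℝ≥0} {W : ℤ → ℝ≥0}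
    (hu : ∀ i, Tendsto (fun n => u n i) atTop (𝓝 (W i))) (f : Config d r) :
    Tendsto (fun n => weight d r (u n) f) atTop (𝓝 (weight d r W f)) := by
  by_cases hf : IsLipschitz (finiteTree d r) f
  · simp only [weight, Set.indicator_of_mem (show f ∈ {f | IsLipschitz _ f} from hf)]
    simp only [← ENNReal.ofNNReal_finsetProd]
    exact ENNReal.tendsto_coe.2 (tendsto_finsetProd _ fun v _ => hu _)
  · simp only [weight, Set.indicator_of_notMem (show f ∉ {f | IsLipschitz _ f} from hf)]
    exact tendsto_const_nhds

theorem tendsto_weightedLaw_singleton {d : ℕ} (hd : d ≠ 0) {u : ℕ → ℤ → ℝ≥0} {W B : ℤ → ℝ≥0}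
    (hu : ∀ i, Tendsto (fun n => u n i) atTop (𝓝 (W i))) (huB : ∀ᶠ n in atTop, ∀ i, u n i ≤ B i)
    (hB : ∑' i, (B i : ℝ≥0∞) ≠ ∞) (hW : 0 < W 0) (r : ℕ) (f : Config d r) :
    Tendsto (fun n => weightedLaw d (u n) r {f}) atTop (𝓝 (weightedLaw d W r {f})) := by
  have hZ := tsum_weight_ne_zero (d := d) (n := r) hW
  have h := tendsto_tsum_iterate_stepWeight hd hu huB hB r
  simp only [← tsum_weight] at h
  simp only [weightedLaw_singleton]
  refine ENNReal.Tendsto.mul (tendsto_inv_iff.2 h) (.inr ?_) (tendsto_weight hu f)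
    (.inr (ENNReal.inv_ne_top.2 hZ))
  unfold weight
  refine ne_top_of_le_ne_top ?_ (Set.indicator_le_self _ _ _)
  rw [← ENNReal.ofNNReal_finsetProd]
  exact ENNReal.coe_ne_top

/-- On a countable space, convergence of the point masses implies weak convergence. -/
theorem tendsto_probabilityMeasure_of_singleton {Ω : Type*} [Countable Ω] [TopologicalSpace Ω]
    [MeasurableSpace Ω] [MeasurableSingletonClass Ω] [OpensMeasurableSpace Ω]
    {μs : ℕ → ProbabilityMeasure Ω} {μ : ProbabilityMeasure Ω}
    (h : ∀ x, Tendsto (fun n => (μs n : Measure Ω) {x}) atTop (𝓝 ((μ : Measure Ω) {x}))) :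
    Tendsto μs atTop (𝓝 μ) := by
  refine tendsto_of_forall_isOpen_le_liminf_nat' fun G hG => ?_
  have hG' := hG.measurableSet
  have key : ∀ ν : Measure Ω, ν G = ∫⁻ x, G.indicator (fun x => ν {x}) x ∂Measure.count := by
    intro ν
    rw [lintegral_count, Measure.tsum_indicator_apply_singleton ν G hG']
  simp only [key]
  -- Fatou's lemma for counting measure gives the portmanteau inequality on open sets.
  refine le_trans (lintegral_mono fun x => ?_)
    (lintegral_liminf_le fun n => measurable_of_countable _)
  refine le_of_eq (Tendsto.liminf_eq ?_).symm
  by_cases hx : x ∈ G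
  · simpa [hx] using h x
  · simp [hx]

/-! ### The infinite-volume measure -/

/-- Extension by zero to the infinite tree. -/
def extendByZero {d n : ℕ} (f : Config d n) (v : List (Fin d)) : ℤ :=
  if h : v.length ≤ n then f ⟨v, h⟩ else 0

theorem measurable_extendByZero {d n : ℕ} :
    Measurable (extendByZero : Config d n → List (Fin d) → ℤ) := by
  refine measurable_pi_lambda _ fun v => ?_
  unfold extendByZero
  split_ifs
  · exact measurable_pi_apply _
  · exact measurable_const

theorem restrictInfinite_extendByZero {d r n : ℕ} (h : r ≤ n) (f : Config d n) :
    restrictInfinite d r (extendByZero f) = restrictLE h f :=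
  funext fun v => dif_pos (le_trans v.2 h)

/-- A consistent family of laws on the balls, extended by zero to the infinite tree, is tight. -/
theorem isTightMeasureSet_extendByZero {d : ℕ} (ν : (n : ℕ) → ProbabilityMeasure (Config d n))
    (hν : ∀ r n (h : r ≤ n), (ν n : Measure (Config d n)).map (restrictLE h) = ν r) :
    IsTightMeasureSet (Set.range fun n => (ν n : Measure (Config d n)).map extendByZero) := by
  rw [isTightMeasureSet_iff_exists_isCompact_measure_compl_le]
  intro ε hε
  obtain ⟨δ, hδ, hδsum⟩ := ENNReal.exists_pos_sum_of_countable hε.ne' (List (Fin d))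
  have hcompact : ∀ v : List (Fin d), ∃ C : Set ℤ, IsCompact C ∧
      ((ν v.length : Measure (Config d v.length)).map
        fun f => f ⟨v, le_refl v.length⟩) Cᶜ ≤ δ v := fun v => by
    have : IsProbabilityMeasure
        ((ν v.length : Measure (Config d v.length)).map fun f => f ⟨v, le_refl v.length⟩) :=
      Measure.isProbabilityMeasure_map (measurable_pi_apply _).aemeasurable
    obtain ⟨C, hC, h⟩ := isTightMeasureSet_iff_exists_isCompact_measure_compl_le.1
      (isTightMeasureSet_singleton (μ := (ν v.length : Measure (Config d v.length)).map
        fun f => f ⟨v, le_refl v.length⟩)) (δ v) (by exact_mod_cast hδ v)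
    exact ⟨C, hC, h _ rfl⟩
  choose C hC hCδ using hcompact
  -- Compact by Tychonoff. By consistency the law of `f v` is the same for all `n ≥ v.length`, so
  -- one `C v` serves them all; for smaller `n` the extension takes the value `0`, which is why `0`
  -- is inserted.
  refine ⟨Set.univ.pi fun v => insert 0 (C v), isCompact_univ_pi fun v => (hC v).insert 0, ?_⟩
  rintro _ ⟨n, rfl⟩
  have hsub : (Set.univ.pi fun v => insert 0 (C v))ᶜ ⊆
      ⋃ v : List (Fin d), {f : List (Fin d) → ℤ | f v ∉ insert 0 (C v)} := by
    intro f hf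
    simpa [Set.mem_pi] using hf
  refine (measure_mono hsub).trans ((measure_iUnion_le _).trans ?_)
  refine le_trans (ENNReal.tsum_le_tsum fun v => ?_) hδsum.le
  have hmeas : MeasurableSet {f : List (Fin d) → ℤ | f v ∉ insert 0 (C v)} :=
    measurable_pi_apply (X := fun _ : List (Fin d) => ℤ) v
      ((insert 0 (C v))ᶜ.to_countable.measurableSet)
  rw [Measure.map_apply measurable_extendByZero hmeas]
  by_cases hv : v.length ≤ n
  · refine le_trans ?_ (hCδ v)
    rw [← hν _ _ hv, Measure.map_map (measurable_pi_apply _) (measurable_restrictLE _),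
      Measure.map_apply ((measurable_pi_apply _).comp (measurable_restrictLE _))
        (C v)ᶜ.to_countable.measurableSet]
    refine measure_mono fun f hf hmem => hf ?_
    simp only [extendByZero, dif_pos hv]
    exact Set.mem_insert_of_mem _ hmem
  · have : extendByZero ⁻¹' {f : List (Fin d) → ℤ | f v ∉ insert 0 (C v)} =
        (∅ : Set (Config d n)) := by
      ext f
      simp [extendByZero, hv]
    rw [this, measure_empty]
    exact zero_le

/-- A consistent family of laws on the balls comes from a law on the infinite tree. -/
theorem exists_projectiveLimit {d : ℕ} (ν : (n : ℕ) → ProbabilityMeasure (Config d n))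
    (hν : ∀ r n (h : r ≤ n), (ν n : Measure (Config d n)).map (restrictLE h) = ν r) :
    ∃ μ : ProbabilityMeasure (List (Fin d) → ℤ), ∀ r,
      μ.map (measurable_restrictInfinite d r).aemeasurable = ν r := by
  let m : ℕ → ProbabilityMeasure (List (Fin d) → ℤ) := fun n =>
    (ν n).map measurable_extendByZero.aemeasurable
  have htight : IsTightMeasureSet
      {((μ : ProbabilityMeasure (List (Fin d) → ℤ)) : Measure (List (Fin d) → ℤ)) |
        μ ∈ Set.range m} := by
    refine (isTightMeasureSet_extendByZero ν hν).subset ?_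
    rintro _ ⟨_, ⟨n, rfl⟩, rfl⟩
    exact ⟨n, rfl⟩
  have hcompact := isCompact_closure_of_isTightMeasureSet htight
  let U := hyperfilter ℕ
  -- By Prokhorov's theorem a limit exists along an ultrafilter. Its marginals are forced, because
  -- the restrictions to radius `r` equal `ν r` for all `n ≥ r`.
  obtain ⟨μ, -, hμ⟩ := hcompact.ultrafilter_le_nhds (U.map m) (by
    rw [le_principal_iff]
    exact mem_map.2 (univ_mem' fun n => subset_closure (Set.mem_range_self (f := m) n)))
  refine ⟨μ, fun r => ?_⟩
  have hcont : Continuous (restrictInfinite d r) :=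
    continuous_pi fun v => continuous_apply v.1
  have hlim := ProbabilityMeasure.tendsto_map_of_tendsto_of_continuous m μ
    (show Tendsto m U (𝓝 μ) from hμ) hcont
  refine tendsto_nhds_unique hlim (tendsto_const_nhds.congr' ?_)
  have hU : (U : Filter ℕ) ≤ atTop := by
    rw [← Nat.cofinite_eq_atTop]; exact hyperfilter_le_cofinite
  filter_upwards [hU (eventually_ge_atTop r)] with n hn
  refine Subtype.ext ?_
  change (ν r : Measure (Config d r)) =
    ((ν n : Measure (Config d n)).map extendByZero).map (restrictInfinite d r)
  rw [Measure.map_map (measurable_restrictInfinite d r) measurable_extendByZero, ← hν r n hn]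
  congr 1
  exact funext fun f => (restrictInfinite_extendByZero hn f).symm

/-! ### Uniform laws as weighted laws -/

theorem uniformLaw_eq_weightedLaw (d n : ℕ) (S : Set ℤ) :
    uniformLaw d S n = weightedLaw d (S.indicator 1) n := by
  classical
  have hw : ∀ f, weight d n (S.indicator 1) f = (lipschitzFunctions d n S).indicator 1 f := by
    intro f
    by_cases hf : IsLipschitz (finiteTree d n) f
    · rw [weight, Set.indicator_of_mem hf]
      by_cases hS : ∀ v : List.Vector (Fin d) n, f (leaf v) ∈ S
      · rw [Set.indicator_of_mem (show f ∈ lipschitzFunctions d n S from ⟨hf, hS⟩)]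
        exact Finset.prod_eq_one fun v _ => by simp [hS v]
      · rw [Set.indicator_of_notMem (fun h : f ∈ lipschitzFunctions d n S => hS h.2)]
        push Not at hS
        obtain ⟨v, hv⟩ := hS
        exact Finset.prod_eq_zero (Finset.mem_univ v) (by simp [hv])
    · rw [weight, Set.indicator_of_notMem hf,
        Set.indicator_of_notMem (fun h : f ∈ lipschitzFunctions d n S => hf h.1)]
  have hcount : ∀ A : Set (Config d n), Measure.count A = ∑' f, A.indicator 1 f := fun A => by
    rw [← lintegral_count, lintegral_indicator_one A.to_countable.measurableSet]
  ext A hA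
  rw [weightedLaw_apply, uniformLaw, ProbabilityTheory.uniformOn,
    ProbabilityTheory.cond_apply (Set.to_countable _).measurableSet, hcount, hcount]
  simp only [hw]
  congr 1
  refine tsum_congr fun f => ?_
  rw [Set.inter_indicator_one]
  rfl

theorem isGood_indicator_Icc (k : ℕ) : IsGood ((Set.Icc (-(k : ℤ)) k).indicator 1) := by
  refine ⟨fun i => ?_, by simp, k, 0, zero_lt_one, fun i hi hik => ?_, fun i hi => ?_⟩
  · have h : -i ∈ Set.Icc (-(k : ℤ)) k ↔ i ∈ Set.Icc (-(k : ℤ)) k := by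
      simp only [Set.mem_Icc]; omega
    simp only [Set.indicator, h, Pi.one_apply]
  · rw [Set.indicator_of_mem (Set.mem_Icc.2 (by omega)),
      Set.indicator_of_mem (Set.mem_Icc.2 (by omega))]
    rfl
  · rw [Set.indicator_of_notMem fun h => by have := (Set.mem_Icc.1 h).2; omega]
    exact zero_le

/-! ### Weights and their ratios -/

/-- `r` is the sequence of ratios `w (i + 1) / w i`, `i ≥ 0`, of the symmetric weight `w`. -/
def HasRatio (w : ℤ → ℝ≥0) (r : ℕ → ℝ) : Prop :=
  0 < w 0 ∧ ∀ i : ℤ, (w i : ℝ) = w 0 * ∏ j ∈ Finset.range i.natAbs, r j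

theorem IsGood.exists_hasRatio {w : ℤ → ℝ≥0} (hw : IsGood w) :
    ∃ r, IsGoodRatio r ∧ HasRatio w r := by
  obtain ⟨hsymm, h0, k, c, hc, hk, hkc⟩ := hw
  have hle : ∀ j : ℕ, w (j + 1) ≤ w j := fun j => by
    rcases lt_or_ge j k with h | h
    · exact (hk j (by omega) (by exact_mod_cast h)).ge
    · exact (hkc j (by exact_mod_cast h)).trans (mul_le_of_le_one_left zero_le hc.le)
  have hle' : ∀ j : ℕ, (w (j + 1) : ℝ) ≤ w j := fun j => by exact_mod_cast hle j
  refine ⟨fun j => w (j + 1) / w j, ⟨fun j => ⟨by positivity,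
    div_le_one_of_le₀ (hle' j) (by positivity)⟩, k, c, by exact_mod_cast hc, fun j hj => ?_⟩,
    h0, fun i => ?_⟩
  · refine div_le_of_le_mul₀ (by positivity) (by positivity) ?_
    exact_mod_cast hkc j (by exact_mod_cast hj)
  · have hnat : ∀ n : ℕ, (w n : ℝ) = w 0 * ∏ j ∈ Finset.range n, ((w (j + 1) : ℝ) / w j) := by
      intro n
      induction n with
      | zero => simp
      | succ n ih =>
        rw [Finset.prod_range_succ, ← mul_assoc, ← ih]
        push_cast
        -- Once a good weight vanishes it stays zero by monotonicity, which agrees with the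
        -- convention `0 / 0 = 0` for the ratios.
        by_cases hz : (w n : ℝ) = 0
        · have := hle' n
          rw [hz] at this ⊢
          rw [zero_mul]
          exact le_antisymm this (by positivity)
        · field_simp
    rw [← hnat]
    rcases Int.natAbs_eq i with h | h
    · rw [← h]
    · rw [← hsymm, show -i = (i.natAbs : ℤ) by omega]

theorem HasRatio.stepWeight {w : ℤ → ℝ≥0} {r : ℕ → ℝ} (h : HasRatio w r) (hr : ∀ i, 0 ≤ r i)
    (d : ℕ) : HasRatio (stepWeight d w) (ratioMap d r) := by
  obtain ⟨h0, hw⟩ := h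
  -- `F n` is the sum of `w` over `n - 1, n, n + 1`, divided by `w 0`; at `n = 0` symmetry gives `1
  -- + 2 * r 0`.
  let F : ℕ → ℝ := fun n => match n with
    | 0 => 1 + 2 * r 0
    | m + 1 => (∏ j ∈ Finset.range m, r j) * (1 + r m + r m * r (m + 1))
  have hF : ∀ i : ℤ, (w (i - 1) + w i + w (i + 1) : ℝ) = w 0 * F i.natAbs := by
    intro i
    rw [hw (i - 1), hw i, hw (i + 1)]
    obtain ⟨n, rfl | rfl⟩ := i.eq_nat_or_neg
    · cases n with
      | zero => simp [F]; ring
      | succ m =>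
        rw [show ((m + 1 : ℕ) - 1 : ℤ).natAbs = m by omega,
          show ((m + 1 : ℕ) : ℤ).natAbs = m + 1 by omega,
          show ((m + 1 : ℕ) + 1 : ℤ).natAbs = m + 2 by omega]
        simp only [Finset.prod_range_succ, F]
        ring
    · cases n with
      | zero => simp [F]; ring
      | succ m =>
        rw [show (-((m + 1 : ℕ) : ℤ) - 1).natAbs = m + 2 by omega,
          show (-((m + 1 : ℕ) : ℤ)).natAbs = m + 1 by omega,
          show (-((m + 1 : ℕ) : ℤ) + 1).natAbs = m by omega]
        simp only [Finset.prod_range_succ, F]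
        ring
  have hF' : ∀ n, F n ^ d = F 0 ^ d * ∏ j ∈ Finset.range n, ratioMap d r j := by
    intro n
    induction n with
    | zero => simp
    | succ n ih =>
      rw [Finset.prod_range_succ, ← mul_assoc, ← ih]
      cases n with
      | zero =>
        have := hr 0
        simp only [F, ratioMap, rootFactor, ← mul_pow]
        congr 1
        field_simp
        simp
      | succ m =>
        have h1 : 1 + r m + r m * r (m + 1) ≠ 0 := by
          have := hr m
          have := hr (m + 1)
          positivity
        simp only [F, ratioMap, ratioFactor, ← mul_pow]
        congr 1
        rw [Finset.prod_range_succ]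
        field_simp
  refine ⟨pow_pos (add_pos_of_pos_of_nonneg (add_pos_of_nonneg_of_pos zero_le h0) zero_le) d,
    fun i => ?_⟩
  simp only [LipschitzTree.stepWeight, NNReal.coe_pow, NNReal.coe_add, hF, mul_pow]
  rw [hF', Int.natAbs_zero]
  ring

theorem HasRatio.iterate_stepWeight {w : ℤ → ℝ≥0} {r : ℕ → ℝ} (h : HasRatio w r)
    (hr : ∀ i, r i ∈ Set.Icc (0 : ℝ) 1) (d n : ℕ) :
    HasRatio ((LipschitzTree.stepWeight d)^[n] w) ((ratioMap d)^[n] r) := by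
  induction n with
  | zero => exact h
  | succ n ih =>
    simp only [Function.iterate_succ_apply']
    exact ih.stepWeight (fun i => (iterate_ratioMap_mem hr n i).1) d

/-- The first `k` factors are only known to be at most `1`; multiplying by `c ^ k` compensates for
them without dividing by a possibly zero `c`. -/
theorem prod_range_mul_pow_le {r : ℕ → ℝ} (hr : ∀ i, r i ∈ Set.Icc (0 : ℝ) 1) {k : ℕ} {c : ℝ}
    (hc0 : 0 ≤ c) (hc1 : c ≤ 1) (h : ∀ i, k ≤ i → r i ≤ c) (n : ℕ) :
    (∏ j ∈ Finset.range n, r j) * c ^ k ≤ c ^ n := by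
  induction n with
  | zero => simpa using pow_le_one₀ hc0 hc1
  | succ n ih =>
    rcases lt_or_ge n k with hn | hn
    · calc _ ≤ 1 * c ^ k := by
            gcongr
            exact Finset.prod_le_one (fun j _ => (hr j).1) fun j _ => (hr j).2
        _ ≤ c ^ (n + 1) := by
            rw [one_mul]; exact pow_le_pow_of_le_one hc0 hc1 hn
    · rw [Finset.prod_range_succ, mul_right_comm, pow_succ]
      exact mul_le_mul ih (h n hn) (hr n).1 (by positivity)

theorem tsum_mul_pow_natAbs_ne_top (C : ℝ≥0) {c : ℝ≥0} (hc : c < 1) :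
    ∑' i : ℤ, ((C * c ^ i.natAbs : ℝ≥0) : ℝ≥0∞) ≠ ∞ := by
  rw [ENNReal.tsum_coe_ne_top_iff_summable, ← NNReal.summable_coe]
  have hgeo : Summable fun n : ℕ => ((C * c ^ n : ℝ≥0) : ℝ) := by
    push_cast
    exact (summable_geometric_of_lt_one c.2 (by exact_mod_cast hc)).mul_left _
  exact Summable.of_nat_of_neg (by simpa using hgeo) (by simpa using hgeo)

theorem HasRatio.tsum_ne_top {w : ℤ → ℝ≥0} {r : ℕ → ℝ} (h : HasRatio w r) (hr : IsGoodRatio r) :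
    ∑' i, (w i : ℝ≥0∞) ≠ ∞ := by
  obtain ⟨hmem, k, c, hc, hkc⟩ := hr
  -- The maximum with `1/2` makes the rate positive, so that `c' ^ k` can be inverted.
  let c' : ℝ≥0 := max c.toNNReal (1 / 2)
  have hc' : c' < 1 := max_lt (by simpa using hc) (by
    rw [← NNReal.coe_lt_coe]; norm_num)
  have hcc' : c ≤ c' := (Real.le_coe_toNNReal c).trans (by exact_mod_cast le_max_left _ _)
  have hpos : 0 < c' := lt_of_lt_of_le (by norm_num) (le_max_right _ _)
  refine ne_top_of_le_ne_top (tsum_mul_pow_natAbs_ne_top (w 0 * (c' ^ k)⁻¹) hc')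
    (ENNReal.tsum_le_tsum fun i => ?_)
  rw [ENNReal.coe_le_coe, ← NNReal.coe_le_coe, h.2 i]
  push_cast
  rw [mul_assoc]
  refine mul_le_mul_of_nonneg_left ?_ (w 0).2
  rw [inv_mul_eq_div, le_div_iff₀ (by positivity)]
  exact prod_range_mul_pow_le hmem c'.2 (by exact_mod_cast hc'.le)
    (fun i hi => (hkc i hi).trans hcc') _

/-! ### Local convergence -/

theorem HasRatio.tendsto_weightedLaw {d : ℕ} (hd : 2 ≤ d) {w W : ℤ → ℝ≥0} {r ρ : ℕ → ℝ}
    (h : HasRatio w r) (hr : IsGoodRatio r) (hW : HasRatio W ρ) (hW0 : W 0 = 1)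
    (hlim : ∀ i, Tendsto (fun n => (ratioMap d)^[n] r i) atTop (𝓝 (ρ i))) (m : ℕ)
    (f : Config d m) :
    Tendsto (fun n => weightedLaw d ((LipschitzTree.stepWeight d)^[n] w) m {f}) atTop
      (𝓝 (weightedLaw d W m {f})) := by
  obtain ⟨hmem, k, c, hc, hkc⟩ := hr
  have hn := fun n => h.iterate_stepWeight hmem d n
  let u : ℕ → ℤ → ℝ≥0 := fun n i =>
    ((LipschitzTree.stepWeight d)^[n] w 0)⁻¹ * (LipschitzTree.stepWeight d)^[n] w i
  have hu : ∀ n i, (u n i : ℝ) = ∏ j ∈ Finset.range i.natAbs, (ratioMap d)^[n] r j := fun n i => by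
    have hpos : ((LipschitzTree.stepWeight d)^[n] w 0 : ℝ) ≠ 0 := by exact_mod_cast (hn n).1.ne'
    simp only [u, NNReal.coe_mul, NNReal.coe_inv, (hn n).2 i]
    rw [inv_mul_cancel_left₀ hpos]
  have hlaw : ∀ n, weightedLaw d ((LipschitzTree.stepWeight d)^[n] w) m =
      weightedLaw d (u n) m := fun n =>
    (weightedLaw_smul (inv_ne_zero (hn n).1.ne') _).symm
  simp only [hlaw]
  -- Eventually every ratio but `r 0` is at most `1/2`; the factor `2` in the dominating weight pays
  -- for `r 0 ≤ 1`.
  refine tendsto_weightedLaw_singleton (by omega) (B := fun i => 2 * (1 / 2) ^ i.natAbs)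
    (fun i => ?_) ?_ (tsum_mul_pow_natAbs_ne_top 2 (by rw [← NNReal.coe_lt_coe]; norm_num))
    hW.1 m f
  · rw [← NNReal.tendsto_coe]
    simp only [hu, hW.2 i, hW0, NNReal.coe_one, one_mul]
    exact tendsto_finsetProd _ fun j _ => hlim j
  · filter_upwards [eventually_iterate_ratioMap_le_half hd hmem hc hkc] with n hhalf i
    rw [← NNReal.coe_le_coe, hu]
    have hb := prod_range_mul_pow_le (iterate_ratioMap_mem (d := d) hmem n) (k := 1) (c := 1 / 2)
      (by norm_num) (by norm_num) (fun i hi => by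
        obtain ⟨j, rfl⟩ : ∃ j, i = j + 1 := ⟨i - 1, by omega⟩
        exact hhalf j) i.natAbs
    push_cast
    linarith

end LipschitzTree

theorem mainTheorem2 (d : ℕ) (hd : 2 ≤ d) (hd' : d ≤ 7) :
    ∃ μ : ProbabilityMeasure (List (Fin d) → ℤ),
      (∀ w : ℤ → ℝ≥0, LipschitzTree.IsGood w →
        LipschitzTree.ConvergesLocally (LipschitzTree.weightedLaw d w) μ) ∧
      (∀ k : ℕ, LipschitzTree.ConvergesLocally
        (LipschitzTree.uniformLaw d (Set.Icc (-(k : ℤ)) k)) μ) := by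
  open LipschitzTree in
  obtain ⟨ρ, hρ, hfix, hgood, hlim⟩ := exists_limit_ratio hd hd'
  let W : ℤ → ℝ≥0 := fun i =>
    ⟨∏ j ∈ Finset.range i.natAbs, ρ j, Finset.prod_nonneg fun j _ => (hρ j).1⟩
  have hWρ : ∀ i, (W i : ℝ) = ∏ j ∈ Finset.range i.natAbs, ρ j := fun _ => rfl
  have hW0 : W 0 = 1 := NNReal.eq (by rw [hWρ]; simp)
  have hW : HasRatio W ρ := ⟨by simp [hW0], fun i => by rw [hWρ, hW0, NNReal.coe_one, one_mul]⟩
  have hprob : ∀ n, IsProbabilityMeasure (weightedLaw d W n) := fun n =>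
    isProbabilityMeasure_weightedLaw (by omega) hW.1 (hW.tsum_ne_top hgood)
  -- As `ρ` is fixed, `stepWeight` only rescales `W`, so its laws do not change; this yields the
  -- consistency required for `μ`.
  have hWlaw : ∀ n m, weightedLaw d ((stepWeight d)^[n] W) m = weightedLaw d W m := fun n m => by
    have h := hW.iterate_stepWeight hρ d n
    rw [Function.iterate_fixed hfix] at h
    rw [← weightedLaw_smul h.1.ne' W]
    congr 1
    ext i
    rw [h.2 i, NNReal.coe_mul, hW.2 i, hW0, NNReal.coe_one, one_mul]
  obtain ⟨μ, hμ⟩ := exists_projectiveLimit (fun n => ⟨weightedLaw d W n, hprob n⟩)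
    fun r n h => (map_weightedLaw h W).trans (hWlaw _ _)
  have main : ∀ w : ℤ → ℝ≥0, IsGood w → ConvergesLocally (weightedLaw d w) μ := by
    intro w hw
    obtain ⟨r, hr, hwr⟩ := hw.exists_hasRatio
    refine ⟨fun n => isProbabilityMeasure_weightedLaw (by omega) hwr.1 (hwr.tsum_ne_top hr),
      fun m => ?_⟩
    rw [hμ m]
    refine tendsto_probabilityMeasure_of_singleton fun f => ?_
    refine (hwr.tendsto_weightedLaw hd hr hW hW0 (hlim r hr) m f).congr fun n => ?_
    have h := map_weightedLaw (d := d) (Nat.le_add_left m n) w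
    rw [Nat.add_sub_cancel] at h
    rw [← h]
    rfl
  refine ⟨μ, main, fun k => ?_⟩
  rw [show uniformLaw d (Set.Icc (-(k : ℤ)) k) = weightedLaw d _ from
    funext fun n => uniformLaw_eq_weightedLaw d n _]
  exact main _ (isGood_indicator_Icc k)
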